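/- Let $\Omega\subset\mathbb R^d$ be open, let $K_1,\dots,K_{N}\subset\Omega$ be a coarse grid of mesh size $H>0$: the $K_i$ are pairwise disjoint convex open sets whose closures cover $\Omega$, and each $K_i$ lies in an axis-parallel cube of side $H$. Let $\Omega_\kappa\subset\Omega$ be measurable, $\kappa_{\max}\ge 1$, and let $\kappa=\kappa_{\max}$ on $\Omega_\kappa$ and $\kappa=1$ on $\Omega\setminus\Omega_\kappa$. Put $V=H^1_0(\Omega)$, $(u,v)=\int_\Omega uv$, $a(u,v)=\int_\Omega\kappa\nabla u\cdot\nabla v$, $\|v\|_a=a(v,v)^{1/2}$, $s_i(u,v)=\int_{K_i}H^{-2}\kappa\,uv$, $s=\sum_i s_i$, and $V_\kappa(K_i)=\{v\in H^1(K_i): v=0 \text{ a.e. on } \Omega_\kappa\cap K_i\}$; functions on $K_i$ are extended by zero. For each $i$ let $\psi^{(i)}_1,\dots,\psi^{(i)}_{L_i}$ be the first $L_i$ eigenfunctions, with eigenvalues $\lambda^{(i)}_j$ in increasing order, of $$\int_{K_i}\kappa\nabla\psi\cdot\nabla v=\lambda\, s_i(\psi,v)\qquad\forall v\in V_\kappa(K_i),$$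 let $V_{aux,1}$ be the span of all $\psi^{(i)}_j$, and let $\Pi$ be the $s$-orthogonal projection onto $V_{aux,1}$. Let $\xi^{(i)}_1,\dots,\xi^{(i)}_{J_i}$ be the first $J_i$ eigenfunctions, with eigenvalues $\gamma^{(i)}_j$, in the space $\{v\in V_\kappa(K_i):\Pi v=0\}$ of $$\int_{K_i}\kappa\nabla\xi\cdot\nabla v=\gamma H^{-2}\int_{K_i}\xi v\qquad\forall v\in V_\kappa(K_i)\text{ with }\Pi v=0,$$ and let $V_{aux,2}$ be the span of all $\xi^{(i)}_j$. (In both problems the chosen eigenfunctions are orthonormal for the bilinear form on the right.) Let $V_{glo,2}$ be the span of the functions $\zeta^{(i)}_j\in V$ for which there are $\mu^1\in V_{aux,1}$, $\mu^2\in V_{aux,2}$ with $$a(\zeta^{(i)}_j,v)+s(\mu^1,v)+(\mu^2,v)=0\quad\forall v\in V,$$ $$s(\zeta^{(i)}_j,\nu)=0\quad\forall\nu\in V_{aux,1},\qquad (\zeta^{(i)}_j,\nu)=(\xi^{(i)}_j,\nu)\quad\forall\nu\in V_{aux,2}.$$ Let $B_i\in C_c^\infty(K_i)$ satisfy $B_i\ge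 0$, $\|B_i\|_{L^\infty}=1$, $\|\nabla B_i\|_{L^\infty}\le DH^{-1}$, let $B=B_i$ on $K_i$, and suppose $$\sup_{w_1\in V_{aux,1},\,w_2\in V_{aux,2}}\frac{\int_\Omega Bw_1w_2}{\|B^{1/2}w_1\|_{L^2}\|B^{1/2}w_2\|_{L^2}}\le\gamma_1<1,\qquad \sup_{w_2\in V_{aux,2}}\frac{\|w_2\|_{L^2}}{\|B^{1/2}w_2\|_{L^2}}\le\gamma_2<\infty,$$ and $\lambda^{(i)}_j\le E$ for all $i$ and $j\le L_i$, $\gamma^{(i)}_j\le E$ for all $i$ and $j\le J_i$. Then there is a constant $C>0$ that depends only on $d$, $D$, $E$, $\gamma_1$ and $\gamma_2$ (in particular not on $\kappa_{\max}$, $\Omega_\kappa$, $\Omega$, $H$ or the grid) such that $$\|v\|_a\le C H^{-1}\|v\|_{L^2}\qquad\forall v\in V_{glo,2}.$$ -/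

import Mathlib

open MeasureTheory Set
open scoped ContDiff ENNReal

noncomputable section

namespace HighContrast

/-- The space `ℝ^d` with its Euclidean norm. -/
abbrev Pt (d : ℕ) : Type := EuclideanSpace ℝ (Fin d)

/-- `L²(ℝ^d)`. For a measurable set `U`, the space `L²(U)` is identified with the elements
that vanish a.e. outside `U` (extension by zero). -/
abbrev L2 (d : ℕ) : Type := Lp ℝ 2 (volume : Measure (Pt d))

/-- Square integrable vector fields on `ℝ^d`. -/
abbrev L2Field (d : ℕ) : Type := Lp (Pt d) 2 (volume : Measure (Pt d))

/-- Pairs `(u, g)`; in the Sobolev spaces below `g` is the weak gradient of `u`. -/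
abbrev Pair (d : ℕ) : Type := L2 d × L2Field d

/-- `φ ∈ C_c^∞(U)`. -/
structure IsTest {d : ℕ} (U : Set (Pt d)) (φ : Pt d → ℝ) : Prop where
  smooth : ContDiff ℝ ∞ φ
  compact : HasCompactSupport φ
  subset : tsupport φ ⊆ U

/-- `H¹(U)`, `U` open: the pairs `(u, ∇u)` with `u ∈ L²(U)` and weak gradient `∇u ∈ L²(U)`,
both extended by zero outside `U`. -/
def H1 {d : ℕ} (U : Set (Pt d)) : Set (Pair d) :=
  {p | (∀ᵐ x, x ∉ U → p.1 x = 0) ∧ (∀ᵐ x, x ∉ U → p.2 x = 0) ∧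
    ∀ φ : Pt d → ℝ, IsTest U φ →
      ∫ x, p.1 x • gradient φ x = - ∫ x, φ x • p.2 x}

/-- `H¹₀(U)`: the closure of `{(φ, ∇φ) : φ ∈ C_c^∞(U)}` in the `H¹` norm. -/
def H10 {d : ℕ} (U : Set (Pt d)) : Set (Pair d) :=
  closure {p | ∃ φ : Pt d → ℝ, IsTest U φ ∧ p.1 =ᵐ[volume] φ ∧ p.2 =ᵐ[volume] gradient φ}

/-- The domain, the coarse grid and the two-valued coefficient. -/
structure Setup (d : ℕ) where
  /-- The domain. -/
  Om : Set (Pt d)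
  /-- The number of coarse elements. -/
  N : ℕ
  /-- The coarse elements. -/
  K : Fin N → Set (Pt d)
  /-- The coarse mesh size. -/
  H : ℝ
  /-- The high-contrast region. -/
  OmK : Set (Pt d)
  /-- The value of the coefficient on the high-contrast region. -/
  kmax : ℝ
  Om_open : IsOpen Om
  K_open : ∀ i, IsOpen (K i)
  K_convex : ∀ i, Convex ℝ (K i)
  K_subset : ∀ i, K i ⊆ Om
  K_disjoint : Pairwise fun i j => Disjoint (K i) (K j)
  K_cover : Om ⊆ ⋃ i, closure (K i)
  H_pos : 0 < H
  /-- Each element lies in an axis-parallel cube of side `H`; this holds if `H` bounds the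
  diameters, and also for a grid of cubes of side `H`. -/
  K_size : ∀ i, ∀ x ∈ K i, ∀ y ∈ K i, ∀ k, |x k - y k| ≤ H
  OmK_meas : MeasurableSet OmK
  OmK_subset : OmK ⊆ Om
  one_le_kmax : 1 ≤ kmax

namespace Setup

variable {d : ℕ} (S : Setup d)

open Classical in
/-- The coefficient: `kmax` on the high-contrast region, `1` elsewhere. -/
def kappa (x : Pt d) : ℝ := if x ∈ S.OmK then S.kmax else 1

/-- `V = H¹₀(Ω)`. -/
def V : Set (Pair d) := H10 S.Om

/-- `a(u,v) = ∫_Ω κ ∇u · ∇v`. -/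
def a (u v : Pair d) : ℝ := ∫ x in S.Om, S.kappa x * inner ℝ (u.2 x) (v.2 x)

/-- The energy norm `‖v‖_a = a(v,v)^{1/2}`. -/
def energyNorm (v : Pair d) : ℝ := √(S.a v v)

/-- `(u,v) = ∫_Ω u v`. -/
def l2 (u v : L2 d) : ℝ := ∫ x in S.Om, u x * v x

/-- `∫_{K_i} κ ∇u · ∇v`. -/
def aLoc (i : Fin S.N) (u v : Pair d) : ℝ :=
  ∫ x in S.K i, S.kappa x * inner ℝ (u.2 x) (v.2 x)

/-- `s_i(u,v) = ∫_{K_i} H⁻² κ u v`. -/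
def sLoc (i : Fin S.N) (u v : L2 d) : ℝ :=
  ∫ x in S.K i, (S.H ^ 2)⁻¹ * S.kappa x * (u x * v x)

/-- `s(u,v) = ∑_i s_i(u,v)`. -/
def s (u v : L2 d) : ℝ := ∑ i, S.sLoc i u v

/-- `V_κ(K_i)`: the functions in `H¹(K_i)` that vanish on the high-contrast region. -/
def Vk (i : Fin S.N) : Set (Pair d) :=
  {v | v ∈ H1 (S.K i) ∧ ∀ᵐ x, x ∈ S.OmK → v.1 x = 0}

/-- `p = Π u`, the `s`-orthogonal projection of `u` onto `W`. -/
def IsProj (W : Submodule ℝ (L2 d)) (u p : L2 d) : Prop :=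
  p ∈ W ∧ ∀ ν ∈ W, S.s p ν = S.s u ν

/-- The functions in `V_κ(K_i)` whose projection onto `W` is zero. -/
def VkTilde (W : Submodule ℝ (L2 d)) (i : Fin S.N) : Set (Pair d) :=
  {v | v ∈ S.Vk i ∧ S.IsProj W v.1 0}

end Setup

/-- `(ξ, l)` is an eigenpair on the space `X`: `A ξ v = l * M ξ v` for all `v ∈ X`. -/
def IsEigenpair {d : ℕ} (X : Set (Pair d)) (A M : Pair d → Pair d → ℝ)
    (ξ : Pair d) (l : ℝ) : Prop :=
  ξ ∈ X ∧ ξ.1 ≠ 0 ∧ ∀ v ∈ X, A ξ v = l * M ξ v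

/-- `ξ 0, …, ξ (n-1)` are the first `n` eigenfunctions on `X` (`M`-orthonormal, counted with
multiplicity), with the `n` smallest eigenvalues `l 0 ≤ … ≤ l (n-1)`. -/
structure IsFirstEigen {d : ℕ} (X : Set (Pair d)) (A M : Pair d → Pair d → ℝ)
    {n : ℕ} (ξ : Fin n → Pair d) (l : Fin n → ℝ) : Prop where
  eigen : ∀ j, IsEigenpair X A M (ξ j) (l j)
  orthonormal : ∀ j k, M (ξ j) (ξ k) = if j = k then 1 else 0
  mono : Monotone l
  smallest : ∀ v l', IsEigenpair X A M v l' → (∀ j, M (ξ j) v = 0) → ∀ j, l j ≤ l'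

/-- The sum over all elements of the spans of the given local functions. -/
def auxSpace {d N : ℕ} {n : Fin N → ℕ} (ξ : ∀ i, Fin (n i) → Pair d) :
    Submodule ℝ (L2 d) :=
  Submodule.span ℝ {u | ∃ i, ∃ j, u = (ξ i j).1}

namespace Setup

variable {d : ℕ} (S : Setup d)

/-- The local functions `ψ` are the first eigenfunctions of
`∫_{K_i} κ ∇ψ · ∇v = λ s_i(ψ, v)` for all `v ∈ V_κ(K_i)`. Their span is `V_{aux,1}`. -/
def IsAux1 {L : Fin S.N → ℕ} (ψ : ∀ i, Fin (L i) → Pair d) (lam : ∀ i, Fin (L i) → ℝ) :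
    Prop :=
  ∀ i, IsFirstEigen (S.Vk i) (S.aLoc i) (fun u v => S.sLoc i u.1 v.1) (ψ i) (lam i)

/-- The local functions `ξ` are the first eigenfunctions of
`∫_{K_i} κ ∇ξ · ∇v = γ H⁻² ∫_{K_i} ξ v` for all `v ∈ V_κ(K_i)` with `Π v = 0`, where `Π` is
the projection onto `W`. Their span is `V_{aux,2}`. -/
def IsAux2 (W : Submodule ℝ (L2 d)) {J : Fin S.N → ℕ} (ξ : ∀ i, Fin (J i) → Pair d)
    (gam : ∀ i, Fin (J i) → ℝ) : Prop :=
  ∀ i, IsFirstEigen (S.VkTilde W i) (S.aLoc i)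
    (fun u v => (S.H ^ 2)⁻¹ * ∫ x in S.K i, u.1 x * v.1 x) (ξ i) (gam i)

/-- `ζ` is the global basis function belonging to the auxiliary function `ξ`. -/
def IsGlobalBasis (W₁ W₂ : Submodule ℝ (L2 d)) (ξ : L2 d) (ζ : Pair d) : Prop :=
  ζ ∈ S.V ∧ ∃ μ₁ ∈ W₁, ∃ μ₂ ∈ W₂,
    (∀ v ∈ S.V, S.a ζ v + S.s μ₁ v.1 + S.l2 μ₂ v.1 = 0) ∧
    (∀ ν ∈ W₁, S.s ζ.1 ν = 0) ∧
    (∀ ν ∈ W₂, S.l2 ζ.1 ν = S.l2 ξ ν)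

/-- `V_{glo,2}`: the span of the global basis functions belonging to the `ξ i j`. -/
def Vglo2 (W₁ : Submodule ℝ (L2 d)) {J : Fin S.N → ℕ} (ξ : ∀ i, Fin (J i) → Pair d) :
    Submodule ℝ (Pair d) :=
  Submodule.span ℝ {ζ | ∃ i, ∃ j, S.IsGlobalBasis W₁ (auxSpace ξ) (ξ i j).1 ζ}

/-- The bubble functions `B_i ∈ C_c^∞(K_i)`: nonnegative, with maximum `1` and
`|∇B_i| ≤ D / H`. -/
structure IsBubble (D : ℝ) (B : Fin S.N → Pt d → ℝ) : Prop where
  test : ∀ i, IsTest (S.K i) (B i)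
  nonneg : ∀ i x, 0 ≤ B i x
  le_one : ∀ i x, B i x ≤ 1
  attains : ∀ i, ∃ x, B i x = 1
  grad : ∀ i x, ‖gradient (B i) x‖ ≤ D * S.H⁻¹

/-- The global function `B` with `B = B_i` on `K_i`. -/
def bubble (B : Fin S.N → Pt d → ℝ) (x : Pt d) : ℝ := ∑ i, B i x

/-- `‖B^{1/2} w‖_{L²}`. -/
def bubbleNorm (B : Fin S.N → Pt d → ℝ) (w : L2 d) : ℝ :=
  √(∫ x in S.Om, S.bubble B x * (w x) ^ 2)

/-- The supremum over `w₁ ∈ W₁`, `w₂ ∈ W₂` of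
`∫_Ω B w₁ w₂ / (‖B^{1/2} w₁‖ ‖B^{1/2} w₂‖)`. Every quotient is at most `1`, and it counts as
`0` where its denominator (hence its numerator) is zero. -/
def gammaOne (W₁ W₂ : Submodule ℝ (L2 d)) (B : Fin S.N → Pt d → ℝ) : ℝ :=
  ⨆ w : W₁ × W₂, (∫ x in S.Om, S.bubble B x * (w.1.1 x * w.2.1 x)) /
    (S.bubbleNorm B w.1.1 * S.bubbleNorm B w.2.1)

/-- The supremum over `w₂ ∈ W₂` of `‖w₂‖ / ‖B^{1/2} w₂‖`, in `[0,∞]`; it is `∞` if the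
denominator is zero for some nonzero `w₂`. -/
def gammaTwo (W₂ : Submodule ℝ (L2 d)) (B : Fin S.N → Pt d → ℝ) : ℝ≥0∞ :=
  ⨆ w ∈ W₂, ENNReal.ofReal ‖w‖ / ENNReal.ofReal (S.bubbleNorm B w)

end Setup

end HighContrast

end

/-!
A function `v` of the global space solves a saddle point problem: there are multipliers
`μ₁ ∈ V_{aux,1}`, `μ₂ ∈ V_{aux,2}` with `a(v, w) + s(μ₁, w) + (μ₂, w) = 0` for all `w ∈ V`, and `v` is
`s`-orthogonal to `V_{aux,1}` (`Setup.exists_multipliers`). Taking `w = v` gives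
`‖v‖_a² = -(μ₂, v) ≤ ‖μ₂‖ ‖v‖`, so the claim follows from `‖μ₂‖ ≤ C H⁻¹ ‖v‖_a`.

This bound is local (`Setup.integral_multiplier_sq_le`). On an element `K`, put `z = H⁻² μ₁ + μ₂`.
Since `z` is a combination of eigenfunctions with eigenvalues at most `E`, its energy is at most
`2 E H⁻² ‖z‖²`. The auxiliary functions vanish on the high-contrast region, so that the coefficient
disappears from all `L²` terms, and the two auxiliary spaces are `L²`-orthogonal on `K`, so that
`‖μ₂‖ ≤ ‖z‖`. Testing with `w = χ z` for a cutoff function `χ ∈ C_c^∞(K)` gives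
`∫ χ z² = -a(v, χ z) ≤ ‖v‖_a ‖χ z‖_a`. Here `‖χ z‖_a ≤ C H⁻¹ ‖z‖` if `|∇χ| ≤ C H⁻¹`, and what is
needed is `∫ χ z² ≥ ‖z‖² / 2`, with a constant `C` that does not depend on `K`.

The bubble functions themselves may be tiny on most of `K`. They do show that `K` contains a ball
of radius comparable to `H`, about some point `x₀` (`Setup.IsBubble.exists_ball_subset`). Hence, by
convexity, the distance to the complement of `K` grows linearly towards `x₀`, and there are cutoff
functions whose derivative towards `x₀` is of order `1 / ε` on a layer of width `ε`
(`exists_cutoff`). Integrating `div (z² χ (x - x₀))` for such `χ` bounds the mass of `z` in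
the layer by `C ε` times `‖z‖² + H² ‖∇z‖²`, up to the boundary (`setIntegral_layer_le`). For `ε` a
small multiple of `H`, a cutoff function equal to one outside the layer preserves half of the mass
of `z` (`Setup.exists_mass_preserving_cutoff`).

That `χ z` belongs to `H¹₀`, and the product rules used above, are obtained by mollification
(`mem_H10_of_compact`, `IsTest.mulPair_mem`).
-/

namespace HighContrast

/-! ### Weighted bilinear forms on square integrable functions -/

theorem inner_eq_mul (x y : ℝ) : inner ℝ x y = x * y := by
  simp [mul_comm]

theorem ae_fst_add {d : ℕ} (p q : Pair d) : ∀ᵐ x, (p + q).1 x = p.1 x + q.1 x :=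
  Lp.coeFn_add p.1 q.1

theorem ae_snd_add {d : ℕ} (p q : Pair d) : ∀ᵐ x, (p + q).2 x = p.2 x + q.2 x :=
  Lp.coeFn_add p.2 q.2

theorem ae_fst_smul {d : ℕ} (c : ℝ) (p : Pair d) : ∀ᵐ x, (c • p).1 x = c * p.1 x :=
  Lp.coeFn_smul c p.1

theorem ae_snd_smul {d : ℕ} (c : ℝ) (p : Pair d) : ∀ᵐ x, (c • p).2 x = c • p.2 x :=
  Lp.coeFn_smul c p.2

/-- A measurable and bounded weight function. -/
def IsWeight {d : ℕ} (k : Pt d → ℝ) : Prop := Measurable k ∧ ∃ c, ∀ x, |k x| ≤ c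

theorem IsWeight.integrable_inner {d : ℕ} {E : Type*} [NormedAddCommGroup E]
    [InnerProductSpace ℝ E] {k : Pt d → ℝ} (hk : IsWeight k)
    (u v : Lp E 2 (volume : Measure (Pt d))) :
    Integrable (fun x => k x * inner ℝ (u x) (v x)) volume := by
  obtain ⟨hm, c, hc⟩ := hk
  exact (L2.integrable_inner (𝕜 := ℝ) u v).bdd_mul (c := c) hm.aestronglyMeasurable
    (Filter.Eventually.of_forall hc)

/-- The bilinear form `(u, v) ↦ ∫_A k ⟨u, v⟩` on square integrable functions, for a bounded
weight `k`. -/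
noncomputable def weightedForm {d : ℕ} {E : Type*} [NormedAddCommGroup E]
    [InnerProductSpace ℝ E] (k : Pt d → ℝ) (hk : IsWeight k) (A : Set (Pt d)) :
    Lp E 2 (volume : Measure (Pt d)) →ₗ[ℝ] Lp E 2 (volume : Measure (Pt d)) →ₗ[ℝ] ℝ :=
  LinearMap.mk₂ ℝ (fun u v => ∫ x in A, k x * inner ℝ (u x) (v x))
    (fun u u' v => by
      rw [← integral_add (hk.integrable_inner u v).integrableOn
        (hk.integrable_inner u' v).integrableOn]
      refine integral_congr_ae (ae_restrict_of_ae ?_)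
      filter_upwards [Lp.coeFn_add u u'] with x hx
      rw [hx, Pi.add_apply, inner_add_left, mul_add])
    (fun c u v => by
      rw [smul_eq_mul, ← integral_const_mul]
      refine integral_congr_ae (ae_restrict_of_ae ?_)
      filter_upwards [Lp.coeFn_smul c u] with x hx
      rw [hx, Pi.smul_apply, real_inner_smul_left]
      ring)
    (fun u v v' => by
      rw [← integral_add (hk.integrable_inner u v).integrableOn
        (hk.integrable_inner u v').integrableOn]
      refine integral_congr_ae (ae_restrict_of_ae ?_)
      filter_upwards [Lp.coeFn_add v v'] with x hx
      rw [hx, Pi.add_apply, inner_add_right, mul_add])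
    (fun c u v => by
      rw [smul_eq_mul, ← integral_const_mul]
      refine integral_congr_ae (ae_restrict_of_ae ?_)
      filter_upwards [Lp.coeFn_smul c v] with x hx
      rw [hx, Pi.smul_apply, real_inner_smul_right]
      ring)

theorem weightedForm_apply {d : ℕ} {E : Type*} [NormedAddCommGroup E] [InnerProductSpace ℝ E]
    {k : Pt d → ℝ} (hk : IsWeight k) (A : Set (Pt d))
    (u v : Lp E 2 (volume : Measure (Pt d))) :
    weightedForm k hk A u v = ∫ x in A, k x * inner ℝ (u x) (v x) := rfl

theorem weightedForm_comm {d : ℕ} {E : Type*} [NormedAddCommGroup E] [InnerProductSpace ℝ E]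
    {k : Pt d → ℝ} (hk : IsWeight k) (A : Set (Pt d))
    (u v : Lp E 2 (volume : Measure (Pt d))) :
    weightedForm k hk A u v = weightedForm k hk A v u := by
  simp only [weightedForm_apply, real_inner_comm]

theorem weightedForm_self_nonneg {d : ℕ} {E : Type*} [NormedAddCommGroup E]
    [InnerProductSpace ℝ E] {k : Pt d → ℝ} (hk : IsWeight k) (h0 : ∀ x, 0 ≤ k x)
    (A : Set (Pt d)) (u : Lp E 2 (volume : Measure (Pt d))) :
    0 ≤ weightedForm k hk A u u :=
  integral_nonneg fun x => mul_nonneg (h0 x) real_inner_self_nonneg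

theorem weightedForm_sq_le {d : ℕ} {E : Type*} [NormedAddCommGroup E]
    [InnerProductSpace ℝ E] {k : Pt d → ℝ} (hk : IsWeight k) (h0 : ∀ x, 0 ≤ k x)
    (A : Set (Pt d)) (u v : Lp E 2 (volume : Measure (Pt d))) :
    weightedForm k hk A u v ^ 2 ≤ weightedForm k hk A u u * weightedForm k hk A v v :=
  LinearMap.BilinForm.apply_sq_le_of_symm (weightedForm k hk A)
    (weightedForm_self_nonneg hk h0 A) ⟨fun x y => weightedForm_comm hk A x y⟩ u v

theorem isWeight_one {d : ℕ} : IsWeight (fun _ : Pt d => (1 : ℝ)) :=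
  ⟨measurable_const, 1, fun _ => by simp⟩

theorem integrable_L2_mul {d : ℕ} (u v : L2 d) : Integrable (fun x => u x * v x) volume := by
  have := isWeight_one.integrable_inner v u
  simpa using this

/-! ### The coefficient and the forms of the setup -/

namespace Setup

variable {d : ℕ} (S : Setup d)

theorem one_le_kappa (x : Pt d) : 1 ≤ S.kappa x := by
  unfold kappa; split_ifs
  · exact S.one_le_kmax
  · exact le_rfl

theorem kappa_nonneg (x : Pt d) : 0 ≤ S.kappa x := zero_le_one.trans (S.one_le_kappa x)

theorem isWeight_kappa : IsWeight S.kappa := by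
  classical
  refine ⟨?_, S.kmax, fun x => ?_⟩
  · exact Measurable.ite S.OmK_meas measurable_const measurable_const
  · rw [abs_of_nonneg (S.kappa_nonneg x)]
    unfold kappa; split_ifs
    · exact le_rfl
    · exact S.one_le_kmax

theorem a_eq (u v : Pair d) : S.a u v = weightedForm S.kappa S.isWeight_kappa S.Om u.2 v.2 := rfl

theorem aLoc_eq (i : Fin S.N) (u v : Pair d) :
    S.aLoc i u v = weightedForm S.kappa S.isWeight_kappa (S.K i) u.2 v.2 := rfl

theorem sLoc_eq (i : Fin S.N) (u v : L2 d) :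
    S.sLoc i u v = (S.H ^ 2)⁻¹ * weightedForm S.kappa S.isWeight_kappa (S.K i) u v := by
  rw [weightedForm_apply, ← integral_const_mul]
  refine integral_congr_ae (Filter.Eventually.of_forall fun x => ?_)
  simp only [inner_eq_mul, mul_assoc]

theorem setIntegral_mul_eq (A : Set (Pt d)) (u v : L2 d) :
    ∫ x in A, u x * v x = weightedForm _ isWeight_one A u v := by
  rw [weightedForm_apply]
  refine integral_congr_ae (Filter.Eventually.of_forall fun x => ?_)
  simp only [inner_eq_mul, one_mul]

theorem l2_eq (u v : L2 d) : S.l2 u v = weightedForm _ isWeight_one S.Om u v :=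
  setIntegral_mul_eq S.Om u v

theorem K_meas (i : Fin S.N) : MeasurableSet (S.K i) := (S.K_open i).measurableSet

end Setup

/-! ### Test functions and the linear structure of the Sobolev spaces -/

theorem IsTest.differentiable {d : ℕ} {U : Set (Pt d)} {φ : Pt d → ℝ} (h : IsTest U φ) :
    Differentiable ℝ φ := h.smooth.differentiable (by simp)

theorem IsTest.continuous_gradient {d : ℕ} {U : Set (Pt d)} {φ : Pt d → ℝ} (h : IsTest U φ) :
    Continuous (gradient φ) :=
  (InnerProductSpace.toDual ℝ (Pt d)).symm.continuous.comp (h.smooth.continuous_fderiv (by simp))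

theorem IsTest.tsupport_gradient {d : ℕ} {φ : Pt d → ℝ} :
    tsupport (gradient φ) ⊆ tsupport φ := by
  refine (closure_mono fun x hx => ?_).trans (tsupport_fderiv_subset ℝ (f := φ))
  intro h
  apply hx
  simp [gradient, h]

theorem IsTest.gradient_compact {d : ℕ} {U : Set (Pt d)} {φ : Pt d → ℝ} (h : IsTest U φ) :
    HasCompactSupport (gradient φ) :=
  h.compact.of_isClosed_subset (isClosed_tsupport _) IsTest.tsupport_gradient

theorem IsTest.memLp {d : ℕ} {U : Set (Pt d)} {φ : Pt d → ℝ} (h : IsTest U φ) (p : ℝ≥0∞) :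
    MemLp φ p volume := h.smooth.continuous.memLp_of_hasCompactSupport h.compact

theorem IsTest.memLp_gradient {d : ℕ} {U : Set (Pt d)} {φ : Pt d → ℝ} (h : IsTest U φ)
    (p : ℝ≥0∞) : MemLp (gradient φ) p volume :=
  h.continuous_gradient.memLp_of_hasCompactSupport h.gradient_compact

theorem IsTest.mono {d : ℕ} {U U' : Set (Pt d)} {φ : Pt d → ℝ} (h : IsTest U φ) (hU : U ⊆ U') :
    IsTest U' φ := ⟨h.smooth, h.compact, h.subset.trans hU⟩

theorem gradient_add_of_differentiable {d : ℕ} {φ ψ : Pt d → ℝ} (h : Differentiable ℝ φ)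
    (h' : Differentiable ℝ ψ) (x : Pt d) :
    gradient (fun x => φ x + ψ x) x = gradient φ x + gradient ψ x := by
  simp only [gradient]
  rw [fderiv_fun_add (h x) (h' x), map_add]

theorem gradient_mul_of_differentiable {d : ℕ} {φ ψ : Pt d → ℝ} (h : Differentiable ℝ φ)
    (h' : Differentiable ℝ ψ) (x : Pt d) :
    gradient (fun x => φ x * ψ x) x = φ x • gradient ψ x + ψ x • gradient φ x := by
  simp only [gradient]
  rw [fderiv_fun_mul (h x) (h' x), map_add, map_smul, map_smul]

theorem gradient_const_mul_of_differentiable {d : ℕ} {φ : Pt d → ℝ} (h : Differentiable ℝ φ)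
    (c : ℝ) (x : Pt d) : gradient (fun x => c * φ x) x = c • gradient φ x := by
  simp only [gradient]
  rw [fderiv_const_mul (h x), map_smul]

theorem inner_gradient {d : ℕ} (φ : Pt d → ℝ) (x e : Pt d) :
    inner ℝ (gradient φ x) e = fderiv ℝ φ x e := by
  simp [gradient]

theorem IsTest.mul_left {d : ℕ} {U : Set (Pt d)} {φ ψ : Pt d → ℝ} (h : IsTest U φ)
    (h' : ContDiff ℝ ∞ ψ) : IsTest U (fun x => φ x * ψ x) :=
  ⟨h.smooth.mul h', h.compact.mul_right, (tsupport_mul_subset_left).trans h.subset⟩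

theorem IsTest.add {d : ℕ} {U : Set (Pt d)} {φ ψ : Pt d → ℝ} (h : IsTest U φ) (h' : IsTest U ψ) :
    IsTest U (fun x => φ x + ψ x) :=
  ⟨h.smooth.add h'.smooth, h.compact.add h'.compact,
    (tsupport_add φ ψ).trans (union_subset h.subset h'.subset)⟩

theorem integrable_L2_smul {d : ℕ} {E : Type*} [NormedAddCommGroup E] [NormedSpace ℝ E]
    {f : Pt d → ℝ} {g : Pt d → E} (hf : MemLp f 2 volume) (hg : MemLp g 2 volume) :
    Integrable (fun x => f x • g x) volume :=
  memLp_one_iff_integrable.1 (hg.smul hf)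

/-- The space `H¹(U)` as a linear space. -/
def H1Space {d : ℕ} (U : Set (Pt d)) : Submodule ℝ (Pair d) where
  carrier := H1 U
  zero_mem' := by
    have h1 := Lp.coeFn_zero (E := ℝ) (p := 2) (μ := (volume : Measure (Pt d)))
    have h2 := Lp.coeFn_zero (E := Pt d) (p := 2) (μ := (volume : Measure (Pt d)))
    refine ⟨?_, ?_, fun φ hφ => ?_⟩
    · filter_upwards [h1] with x hx _ using hx
    · filter_upwards [h2] with x hx _ using hx
    · rw [integral_eq_zero_of_ae, integral_eq_zero_of_ae, neg_zero]
      · filter_upwards [h2] with x hx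
        simp
      · filter_upwards [h1] with x hx
        simp
  add_mem' := by
    rintro p q ⟨hp1, hp2, hp⟩ ⟨hq1, hq2, hq⟩
    have h1 := ae_fst_add p q
    have h2 := ae_snd_add p q
    refine ⟨?_, ?_, fun φ hφ => ?_⟩
    · filter_upwards [h1, hp1, hq1] with x hx hp hq hU
      rw [hx, hp hU, hq hU, add_zero]
    · filter_upwards [h2, hp2, hq2] with x hx hp hq hU
      rw [hx, hp hU, hq hU, add_zero]
    · have e1 : ∫ x, (p + q).1 x • gradient φ x
          = ∫ x, (p.1 x • gradient φ x + q.1 x • gradient φ x) := by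
        refine integral_congr_ae ?_
        filter_upwards [h1] with x hx
        rw [hx, add_smul]
      have e2 : ∫ x, φ x • (p + q).2 x = ∫ x, (φ x • p.2 x + φ x • q.2 x) := by
        refine integral_congr_ae ?_
        filter_upwards [h2] with x hx
        rw [hx, smul_add]
      rw [e1, e2, integral_add, integral_add, hp φ hφ, hq φ hφ, neg_add]
      · exact integrable_L2_smul (hφ.memLp 2) (Lp.memLp p.2)
      · exact integrable_L2_smul (hφ.memLp 2) (Lp.memLp q.2)
      · exact integrable_L2_smul (Lp.memLp p.1) (hφ.memLp_gradient 2)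
      · exact integrable_L2_smul (Lp.memLp q.1) (hφ.memLp_gradient 2)
  smul_mem' := by
    rintro c p ⟨hp1, hp2, hp⟩
    have h1 := ae_fst_smul c p
    have h2 := ae_snd_smul c p
    refine ⟨?_, ?_, fun φ hφ => ?_⟩
    · filter_upwards [h1, hp1] with x hx hp hU
      rw [hx, hp hU, mul_zero]
    · filter_upwards [h2, hp2] with x hx hp hU
      rw [hx, hp hU, smul_zero]
    · have e1 : ∫ x, (c • p).1 x • gradient φ x = ∫ x, c • (p.1 x • gradient φ x) := by
        refine integral_congr_ae ?_
        filter_upwards [h1] with x hx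
        rw [hx, mul_smul]
      have e2 : ∫ x, φ x • (c • p).2 x = ∫ x, c • (φ x • p.2 x) := by
        refine integral_congr_ae ?_
        filter_upwards [h2] with x hx
        rw [hx, smul_comm]
      rw [e1, e2, integral_smul, integral_smul, hp φ hφ, smul_neg]

/-- The linear space of pairs `(φ, ∇φ)` with `φ ∈ C_c^∞(U)`. -/
def testSpace {d : ℕ} (U : Set (Pt d)) : Submodule ℝ (Pair d) where
  carrier := {p | ∃ φ : Pt d → ℝ, IsTest U φ ∧ p.1 =ᵐ[volume] φ ∧ p.2 =ᵐ[volume] gradient φ}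
  zero_mem' := by
    refine ⟨fun _ => 0, ⟨contDiff_const, HasCompactSupport.zero, by simp [tsupport]⟩, ?_, ?_⟩
    · exact Lp.coeFn_zero ..
    · filter_upwards [Lp.coeFn_zero (E := Pt d) (p := 2) (μ := (volume : Measure (Pt d)))] with x hx
      simp [gradient]
  add_mem' := by
    rintro p q ⟨φ, hφ, hp1, hp2⟩ ⟨ψ, hψ, hq1, hq2⟩
    refine ⟨_, hφ.add hψ, ?_, ?_⟩
    · filter_upwards [ae_fst_add p q, hp1, hq1] with x hx h1 h2
      rw [hx, h1, h2]
    · filter_upwards [ae_snd_add p q, hp2, hq2] with x hx h1 h2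
      rw [gradient_add_of_differentiable hφ.differentiable hψ.differentiable]
      rw [hx, h1, h2]
  smul_mem' := by
    rintro c p ⟨φ, hφ, hp1, hp2⟩
    refine ⟨fun x => c * φ x, ?_, ?_, ?_⟩
    · simpa only [mul_comm] using hφ.mul_left (ψ := fun _ => c) contDiff_const
    · filter_upwards [ae_fst_smul c p, hp1] with x hx h1
      rw [hx, h1]
    · filter_upwards [ae_snd_smul c p, hp2] with x hx h1
      rw [gradient_const_mul_of_differentiable hφ.differentiable]
      rw [hx, h1]

/-- The space `H¹₀(U)` as a closed linear space. -/
noncomputable def H10Space {d : ℕ} (U : Set (Pt d)) : Submodule ℝ (Pair d) := (testSpace U).topologicalClosure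

theorem H10_mono {d : ℕ} {U U' : Set (Pt d)} (h : U ⊆ U') : H10 U ⊆ H10 U' :=
  closure_mono fun _ ⟨φ, hφ, h1, h2⟩ => ⟨φ, hφ.mono h, h1, h2⟩

/-- The space `V_κ(K_i)` as a linear space. -/
noncomputable def Setup.VkSpace {d : ℕ} (S : Setup d) (i : Fin S.N) : Submodule ℝ (Pair d) where
  carrier := S.Vk i
  zero_mem' := by
    refine ⟨(H1Space (S.K i)).zero_mem, ?_⟩
    filter_upwards [Lp.coeFn_zero (E := ℝ) (p := 2) (μ := (volume : Measure (Pt d)))] with x hx _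
      using hx
  add_mem' := by
    rintro p q ⟨hp, hp'⟩ ⟨hq, hq'⟩
    refine ⟨(H1Space (S.K i)).add_mem hp hq, ?_⟩
    filter_upwards [ae_fst_add p q, hp', hq'] with x hx h1 h2 hO
    rw [hx, h1 hO, h2 hO, add_zero]
  smul_mem' := by
    rintro c p ⟨hp, hp'⟩
    refine ⟨(H1Space (S.K i)).smul_mem c hp, ?_⟩
    filter_upwards [ae_fst_smul c p, hp'] with x hx h1 hO
    rw [hx, h1 hO, mul_zero]

/-! ### Mollification -/

/-- Translations act continuously on `L²`. -/
theorem exists_eLpNorm_translate_sub_le {d : ℕ} {E : Type*} [NormedAddCommGroup E]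
    (u : Lp E 2 (volume : Measure (Pt d))) {δ : ℝ} (hδ : 0 < δ) :
    ∃ R > 0, ∀ t : Pt d, ‖t‖ < R →
      eLpNorm (fun x => u (x - t) - u x) 2 volume ≤ ENNReal.ofReal δ := by
  let G : C(Pt d, C(Pt d, Pt d)) :=
    ContinuousMap.curry ⟨fun p : Pt d × Pt d => p.2 - p.1, by fun_prop⟩
  have hG : ∀ t, MeasurePreserving (G t) (volume : Measure (Pt d)) volume := fun t =>
    measurePreserving_sub_right volume t
  have hc : Continuous fun t => Lp.compMeasurePreserving (G t) (hG t) u :=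
    continuous_const.compMeasurePreservingLp G.continuous hG (by simp)
  have h0 : Lp.compMeasurePreserving (G 0) (hG 0) u = u := by
    apply Lp.ext
    filter_upwards [Lp.coeFn_compMeasurePreserving u (hG 0)] with x hx
    rw [hx]
    simp [G]
  obtain ⟨R, hR, h⟩ := Metric.continuousAt_iff.1 (hc.continuousAt (x := (0 : Pt d))) δ hδ
  refine ⟨R, hR, fun t ht => ?_⟩
  have h1 := h (x := t) (by simpa using ht)
  rw [h0, Lp.dist_def] at h1
  have h2 : eLpNorm (fun x => u (x - t) - u x) 2 volume
      = eLpNorm (⇑(Lp.compMeasurePreserving (G t) (hG t) u) - ⇑u) 2 volume := by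
    apply eLpNorm_congr_ae
    filter_upwards [Lp.coeFn_compMeasurePreserving u (hG t)] with x hx
    rw [Pi.sub_apply, hx]
    simp [G]
  rw [h2]
  exact (ENNReal.le_ofReal_iff_toReal_le
    (((Lp.memLp _).sub (Lp.memLp u)).eLpNorm_ne_top) hδ.le).2 h1.le

open Convolution in
/-- Averaging over small translations changes an `L²` function little: Jensen's inequality for the
averaging measure, then Tonelli. -/
theorem eLpNorm_convolution_sub_le {d : ℕ} {E : Type*} [NormedAddCommGroup E] [NormedSpace ℝ E]
    [CompleteSpace E] [SecondCountableTopology E]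
    (u : Lp E 2 (volume : Measure (Pt d))) {δ : ℝ≥0∞} {R : ℝ}
    (hu : ∀ t : Pt d, ‖t‖ < R → eLpNorm (fun x => u (x - t) - u x) 2 volume ≤ δ)
    {φ : Pt d → ℝ} (hc : Continuous φ) (hs : HasCompactSupport φ) (h0 : ∀ x, 0 ≤ φ x)
    (h1 : ∫ x, φ x = 1) (hR : Function.support φ ⊆ Metric.ball 0 R) :
    eLpNorm (fun x => (φ ⋆[ContinuousLinearMap.lsmul ℝ ℝ, volume] ⇑u) x - u x) 2 volume ≤ δ := by
  have hφi : Integrable φ volume := hc.integrable_of_hasCompactSupport hs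
  -- the averaging measure `φ dt`
  set ν : Measure (Pt d) := volume.withDensity fun t => ENNReal.ofReal (φ t) with hν
  have hmeas : Measurable fun t => ENNReal.ofReal (φ t) := hc.measurable.ennreal_ofReal
  have hprob : IsProbabilityMeasure ν := by
    constructor
    rw [hν, withDensity_apply _ MeasurableSet.univ, Measure.restrict_univ,
      ← ofReal_integral_eq_lintegral_ofReal hφi (Filter.Eventually.of_forall h0), h1,
      ENNReal.ofReal_one]
  have hloc : LocallyIntegrable (⇑u) volume := (Lp.memLp u).locallyIntegrable (by norm_num)
  have hsm : StronglyMeasurable (⇑u) := Lp.stronglyMeasurable u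
  have hconv : ∀ x, Integrable (fun t => φ t • u (x - t)) volume := fun x =>
    hs.convolutionExists_left (ContinuousLinearMap.lsmul ℝ ℝ) hc hloc x
  have hpt : ∀ x, ‖(φ ⋆[ContinuousLinearMap.lsmul ℝ ℝ, volume] ⇑u) x - u x‖ₑ ^ (2 : ℝ)
      ≤ ∫⁻ t, ‖u (x - t) - u x‖ₑ ^ (2 : ℝ) ∂ν := by
    intro x
    have e1 : (φ ⋆[ContinuousLinearMap.lsmul ℝ ℝ, volume] ⇑u) x - u x
        = ∫ t, φ t • (u (x - t) - u x) := by
      simp_rw [smul_sub]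
      rw [integral_sub (hconv x) (hφi.smul_const _), integral_smul_const, h1, one_smul]
      rfl
    have e2 : ∫ t, φ t • (u (x - t) - u x) = ∫ t, (u (x - t) - u x) ∂ν := by
      rw [hν, integral_withDensity_eq_integral_toReal_smul hmeas
        (Filter.Eventually.of_forall fun t => ENNReal.ofReal_lt_top)]
      simp_rw [ENNReal.toReal_ofReal (h0 _)]
    have hm : AEStronglyMeasurable (fun t => u (x - t) - u x) ν :=
      ((hsm.comp_measurable (measurable_const.sub measurable_id)).sub
        stronglyMeasurable_const).aestronglyMeasurable
    rw [e1, e2]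
    calc ‖∫ t, (u (x - t) - u x) ∂ν‖ₑ ^ (2 : ℝ)
        ≤ (eLpNorm (fun t => u (x - t) - u x) 1 ν) ^ (2 : ℝ) := by
          gcongr
          rw [eLpNorm_one_eq_lintegral_enorm]
          exact enorm_integral_le_lintegral_enorm _
      _ ≤ (eLpNorm (fun t => u (x - t) - u x) 2 ν) ^ (2 : ℝ) := by
          gcongr
          exact eLpNorm_le_eLpNorm_of_exponent_le (by norm_num) hm
      _ = ∫⁻ t, ‖u (x - t) - u x‖ₑ ^ (2 : ℝ) ∂ν := by
          rw [eLpNorm_eq_lintegral_rpow_enorm_toReal (by norm_num) (by norm_num),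
            ← ENNReal.rpow_mul]
          norm_num
  have hsq : ∀ f : Pt d → E, eLpNorm f 2 volume ^ (2 : ℝ)
      = ∫⁻ x, ‖f x‖ₑ ^ (2 : ℝ) := fun f => by
    rw [eLpNorm_eq_lintegral_rpow_enorm_toReal (by norm_num) (by norm_num), ← ENNReal.rpow_mul]
    norm_num
  rw [← ENNReal.rpow_le_rpow_iff (z := (2 : ℝ)) (by norm_num), hsq]
  calc ∫⁻ x, ‖(φ ⋆[ContinuousLinearMap.lsmul ℝ ℝ, volume] ⇑u) x - u x‖ₑ ^ (2 : ℝ)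
      ≤ ∫⁻ x, ∫⁻ t, ‖u (x - t) - u x‖ₑ ^ (2 : ℝ) ∂ν := lintegral_mono hpt
    _ = ∫⁻ t, (∫⁻ x, ‖u (x - t) - u x‖ₑ ^ (2 : ℝ)) ∂ν := by
        refine lintegral_lintegral_swap (μ := volume) (ν := ν)
          (f := fun x t => ‖u (x - t) - u x‖ₑ ^ (2 : ℝ)) ?_
        refine Measurable.aemeasurable ?_
        refine Measurable.pow_const ?_ _
        exact ((hsm.comp_measurable (measurable_fst.sub measurable_snd)).sub
          (hsm.comp_measurable measurable_fst)).enorm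
    _ ≤ ∫⁻ _, δ ^ (2 : ℝ) ∂ν := by
        refine lintegral_mono_ae ((ae_withDensity_iff hmeas).2 (Filter.Eventually.of_forall ?_))
        intro t ht
        rw [← hsq fun x => u (x - t) - u x]
        gcongr
        have ht' : t ∈ Metric.ball 0 R := hR fun h => ht (by simp [h])
        exact hu t (by simpa using ht')
    _ = δ ^ (2 : ℝ) := by simp

open Convolution in
/-- The gradient of a mollified `H¹(ℝ^d)` function is the mollified weak gradient. -/
theorem gradient_convolution_of_mem_H1 {d : ℕ} {p : Pair d} (hp : p ∈ H1 univ) {φ : Pt d → ℝ}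
    (hφ : IsTest univ φ) (x : Pt d) :
    gradient (φ ⋆[ContinuousLinearMap.lsmul ℝ ℝ, volume] ⇑p.1) x
      = (φ ⋆[ContinuousLinearMap.lsmul ℝ ℝ, volume] ⇑p.2) x := by
  have hloc : LocallyIntegrable (⇑p.1) volume := (Lp.memLp p.1).locallyIntegrable (by norm_num)
  have hd := (hφ.compact.hasFDerivAt_convolution_left (ContinuousLinearMap.lsmul ℝ ℝ)
    (hφ.smooth.of_le (by simp)) hloc x).fderiv
  rw [gradient, hd, convolution, convolution]
  refine ((InnerProductSpace.toDual ℝ (Pt d)).symm.toContinuousLinearEquiv.integral_comp_comm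
    _).symm.trans ?_
  have e1 : ∀ t, (InnerProductSpace.toDual ℝ (Pt d)).symm.toContinuousLinearEquiv
      (((ContinuousLinearMap.lsmul ℝ ℝ).precompL (Pt d)) (fderiv ℝ φ t) (p.1 (x - t)))
        = p.1 (x - t) • gradient φ t := by
    intro t
    have : ((ContinuousLinearMap.lsmul ℝ ℝ).precompL (Pt d)) (fderiv ℝ φ t) (p.1 (x - t))
        = p.1 (x - t) • fderiv ℝ φ t := by
      ext y
      simp [ContinuousLinearMap.precompL_apply, mul_comm]
    rw [this, map_smul]
    rfl
  simp_rw [e1]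
  -- the weak gradient is tested with `y ↦ φ (x - y)`
  have hψ : IsTest univ (fun y => φ (x - y)) := by
    refine ⟨hφ.smooth.comp (contDiff_const.sub contDiff_id), ?_, subset_univ _⟩
    exact hφ.compact.comp_homeomorph (Homeomorph.subLeft x)
  have hg : ∀ y, gradient (fun y => φ (x - y)) y = - gradient φ (x - y) := by
    intro y
    have h1 : HasFDerivAt (fun y => φ (x - y)) (-(fderiv ℝ φ (x - y))) y := by
      have := (hφ.differentiable (x - y)).hasFDerivAt.comp y ((hasFDerivAt_id y).const_sub x)
      convert! this using 1
      ext v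
      simp
    rw [gradient, h1.fderiv, map_neg]
    rfl
  have h := hp.2.2 _ hψ
  simp_rw [hg, smul_neg, integral_neg, neg_inj] at h
  calc ∫ t, p.1 (x - t) • gradient φ t = ∫ y, p.1 y • gradient φ (x - y) := by
        rw [← integral_sub_left_eq_self _ volume x]
        simp
    _ = ∫ y, φ (x - y) • p.2 y := h
    _ = ∫ t, φ t • p.2 (x - t) := by
        rw [← integral_sub_left_eq_self _ volume x]
        simp

open Convolution in
theorem convolution_eq_zero_of_notMem_cthickening {d : ℕ} {E : Type*} [NormedAddCommGroup E]
    [NormedSpace ℝ E] {u : Pt d → E} {T : Set (Pt d)} (hu : ∀ᵐ x, x ∉ T → u x = 0)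
    {φ : Pt d → ℝ} {R : ℝ} (hR : Function.support φ ⊆ Metric.ball 0 R) {x : Pt d}
    (hx : x ∉ Metric.cthickening R T) :
    (φ ⋆[ContinuousLinearMap.lsmul ℝ ℝ, volume] u) x = 0 := by
  rw [convolution]
  refine integral_eq_zero_of_ae ?_
  have h := (Measure.measurePreserving_sub_left volume x).quasiMeasurePreserving.ae hu
  filter_upwards [h] with t ht
  by_cases h0 : φ t = 0
  · simp [h0]
  · have ht' : ‖t‖ < R := by simpa using hR h0
    rw [ht]
    · simp
    · intro hT
      apply hx
      refine Metric.mem_cthickening_of_dist_le x (x - t) R T hT ?_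
      simpa [dist_eq_norm] using ht'.le

open Convolution in
/-- An `H¹` function on the whole space that vanishes outside a compact subset of the open set `U`
belongs to `H¹₀(U)`: its mollifications are test functions on `U`. -/
theorem mem_H10_of_compact {d : ℕ} {p : Pair d} (hp : p ∈ H1 univ) {T U : Set (Pt d)}
    (hT : IsCompact T) (hU : IsOpen U) (hTU : T ⊆ U) (h1 : ∀ᵐ x, x ∉ T → p.1 x = 0) :
    p ∈ H10 U := by
  rw [H10, Metric.mem_closure_iff]
  intro δ hδ
  obtain ⟨R₁, hR₁, hu⟩ := exists_eLpNorm_translate_sub_le p.1 (half_pos hδ)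
  obtain ⟨R₂, hR₂, hg⟩ := exists_eLpNorm_translate_sub_le p.2 (half_pos hδ)
  obtain ⟨R₃, hR₃, hthick⟩ := hT.exists_cthickening_subset_open hU hTU
  set R := min (min R₁ R₂) R₃
  have hR : 0 < R := by positivity
  let b : ContDiffBump (0 : Pt d) := ⟨R / 2, R, by positivity, by linarith⟩
  set φ : Pt d → ℝ := b.normed volume
  have hφ : IsTest univ φ := ⟨b.contDiff_normed, b.hasCompactSupport_normed, subset_univ _⟩
  have hsupp : Function.support φ ⊆ Metric.ball 0 R := b.support_normed_eq.subset
  have hloc1 : LocallyIntegrable (⇑p.1) volume := (Lp.memLp p.1).locallyIntegrable (by norm_num)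
  have hsub : ∀ x, x ∉ Metric.cthickening R T →
      (φ ⋆[ContinuousLinearMap.lsmul ℝ ℝ, volume] ⇑p.1) x = 0 := fun x hx =>
    convolution_eq_zero_of_notMem_cthickening h1 hsupp hx
  have htest : IsTest U (φ ⋆[ContinuousLinearMap.lsmul ℝ ℝ, volume] ⇑p.1) := by
    refine ⟨hφ.compact.contDiff_convolution_left _ hφ.smooth hloc1,
      HasCompactSupport.intro hT.cthickening hsub, ?_⟩
    have h2 : Metric.cthickening R T ⊆ U :=
      (Metric.cthickening_mono (min_le_right (min R₁ R₂) R₃) T).trans hthick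
    refine Subset.trans (closure_minimal (fun x hx => ?_) Metric.isClosed_cthickening) h2
    by_contra h
    exact hx (hsub x h)
  refine ⟨((htest.memLp 2).toLp _, (htest.memLp_gradient 2).toLp _),
    ⟨_, htest, (htest.memLp 2).coeFn_toLp, (htest.memLp_gradient 2).coeFn_toLp⟩, ?_⟩
  rw [dist_comm, Prod.dist_eq, max_lt_iff]
  have key : ∀ {E : Type} [NormedAddCommGroup E] [NormedSpace ℝ E] [CompleteSpace E]
      [SecondCountableTopology E] (u w : Lp E 2 (volume : Measure (Pt d))),
      (∀ t : Pt d, ‖t‖ < R → eLpNorm (fun x => u (x - t) - u x) 2 volume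
        ≤ ENNReal.ofReal (δ / 2)) →
      w =ᵐ[volume] (φ ⋆[ContinuousLinearMap.lsmul ℝ ℝ, volume] ⇑u) → dist w u < δ := by
    intro E _ _ _ _ u w hu hw
    have h := eLpNorm_convolution_sub_le u hu hφ.smooth.continuous hφ.compact
      (fun x => b.nonneg_normed x) b.integral_normed hsupp
    rw [Lp.dist_def]
    refine lt_of_le_of_lt (ENNReal.toReal_le_of_le_ofReal (half_pos hδ).le (le_trans (le_of_eq ?_) h))
      (half_lt_self hδ)
    apply eLpNorm_congr_ae
    filter_upwards [hw] with x hx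
    rw [Pi.sub_apply, hx]
  constructor
  · exact key _ _ (fun t ht => hu t (ht.trans_le ((min_le_left _ _).trans (min_le_left _ _))))
      (htest.memLp 2).coeFn_toLp
  · refine key _ _ (fun t ht => hg t (ht.trans_le ((min_le_left _ _).trans (min_le_right _ _))))
      ((htest.memLp_gradient 2).coeFn_toLp.trans (Filter.Eventually.of_forall fun x => ?_))
    exact gradient_convolution_of_mem_H1 hp hφ x

/-! ### Products of Sobolev functions and test functions -/

theorem IsTest.memLp_smul {d : ℕ} {U : Set (Pt d)} {η : Pt d → ℝ} (hη : IsTest U η)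
    {E : Type*} [NormedAddCommGroup E] [NormedSpace ℝ E]
    (u : Lp E 2 (volume : Measure (Pt d))) : MemLp (fun x => η x • u x) 2 volume :=
  (Lp.memLp u).smul (hη.memLp ⊤)

theorem IsTest.memLp_smul_gradient {d : ℕ} {U : Set (Pt d)} {η : Pt d → ℝ} (hη : IsTest U η)
    (u : L2 d) : MemLp (fun x => u x • gradient η x) 2 volume :=
  (hη.memLp_gradient ⊤).smul (Lp.memLp u)

/-- The product `(η u, η ∇u + u ∇η)` of a test function `η` and a pair `(u, ∇u)`. -/
noncomputable def IsTest.mulPair {d : ℕ} {U : Set (Pt d)} {η : Pt d → ℝ} (hη : IsTest U η)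
    (p : Pair d) : Pair d :=
  ((hη.memLp_smul p.1).toLp _, ((hη.memLp_smul p.2).add (hη.memLp_smul_gradient p.1)).toLp _)

theorem IsTest.mulPair_fst {d : ℕ} {U : Set (Pt d)} {η : Pt d → ℝ} (hη : IsTest U η)
    (p : Pair d) : ∀ᵐ x, (hη.mulPair p).1 x = η x * p.1 x :=
  (hη.memLp_smul p.1).coeFn_toLp

theorem IsTest.mulPair_snd {d : ℕ} {U : Set (Pt d)} {η : Pt d → ℝ} (hη : IsTest U η)
    (p : Pair d) : ∀ᵐ x, (hη.mulPair p).2 x = η x • p.2 x + p.1 x • gradient η x :=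
  ((hη.memLp_smul p.2).add (hη.memLp_smul_gradient p.1)).coeFn_toLp

/-- The product of an `H¹(U)` function and a test function on `U` belongs to `H¹₀(U)`. -/
theorem IsTest.mulPair_mem {d : ℕ} {U : Set (Pt d)} (hU : IsOpen U) {η : Pt d → ℝ}
    (hη : IsTest U η) {p : Pair d} (hp : p ∈ H1 U) : hη.mulPair p ∈ H10 U := by
  refine mem_H10_of_compact ?_ hη.compact hU hη.subset ?_
  · refine ⟨by simp, by simp, fun φ hφ => ?_⟩
    have h1 := hp.2.2 _ (hη.mul_left hφ.smooth)
    have i1 : Integrable (fun x => (η x * p.1 x) • gradient φ x) volume :=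
      integrable_L2_smul (hη.memLp_smul p.1) (hφ.memLp_gradient 2)
    have i2 : Integrable (fun x => p.1 x • (φ x • gradient η x)) volume := by
      have := integrable_L2_smul (hφ.memLp 2) (hη.memLp_smul_gradient p.1)
      exact this.congr (Filter.Eventually.of_forall fun x => smul_comm _ _ _)
    have i3 : Integrable (fun x => φ x • (η x • p.2 x)) volume :=
      integrable_L2_smul (hφ.memLp 2) (hη.memLp_smul p.2)
    have e1 : ∫ x, (hη.mulPair p).1 x • gradient φ x = ∫ x, (η x * p.1 x) • gradient φ x := by
      refine integral_congr_ae ?_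
      filter_upwards [hη.mulPair_fst p] with x hx
      rw [hx]
    have e2 : ∫ x, φ x • (hη.mulPair p).2 x
        = ∫ x, (φ x • (η x • p.2 x) + p.1 x • (φ x • gradient η x)) := by
      refine integral_congr_ae ?_
      filter_upwards [hη.mulPair_snd p] with x hx
      rw [hx, smul_add, smul_comm (p.1 x)]
    have e3 : ∫ x, p.1 x • gradient (fun x => η x * φ x) x
        = ∫ x, ((η x * p.1 x) • gradient φ x + p.1 x • (φ x • gradient η x)) := by
      refine integral_congr_ae (Filter.Eventually.of_forall fun x => ?_)
      simp only [gradient_mul_of_differentiable hη.differentiable hφ.differentiable]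
      rw [smul_add, smul_smul, mul_comm]
    have e4 : ∫ x, (η x * φ x) • p.2 x = ∫ x, φ x • (η x • p.2 x) := by
      refine integral_congr_ae (Filter.Eventually.of_forall fun x => ?_)
      simp only [smul_smul, mul_comm]
    rw [e3, e4, integral_add i1 i2] at h1
    rw [e1, e2, integral_add i3 i2, neg_add, ← h1]
    abel
  · filter_upwards [hη.mulPair_fst p] with x hx hx'
    rw [hx, image_eq_zero_of_notMem_tsupport hx', zero_mul]

/-- Integration by parts for one function in `H¹(U)` and one in `H¹₀(U)`, in the direction `e`. -/
theorem integral_mul_inner_eq_neg {d : ℕ} {U : Set (Pt d)} {p q : Pair d} (hp : p ∈ H1 U)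
    (hq : q ∈ H10 U) (e : Pt d) :
    ∫ x, p.1 x * inner ℝ (q.2 x) e = - ∫ x, q.1 x * inner ℝ (p.2 x) e := by
  let P : L2Field d := (ContinuousLinearMap.toSpanSingleton ℝ e).compLp p.1
  have hP : ∀ᵐ x, P x = p.1 x • e := by
    filter_upwards [(ContinuousLinearMap.toSpanSingleton ℝ e).coeFn_compLp p.1] with x hx
    rw [hx]; simp
  let Q : L2 d := (innerSL ℝ e).compLp p.2
  have hQ : ∀ᵐ x, Q x = inner ℝ (p.2 x) e := by
    filter_upwards [(innerSL ℝ e).coeFn_compLp p.2] with x hx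
    rw [hx]; simp [real_inner_comm]
  have e1 : ∀ q : Pair d, ∫ x, p.1 x * inner ℝ (q.2 x) e = inner ℝ P q.2 := fun q => by
    rw [L2.inner_def]
    refine integral_congr_ae ?_
    filter_upwards [hP] with x hx
    rw [hx, real_inner_smul_left, real_inner_comm]
  have e2 : ∀ q : Pair d, ∫ x, q.1 x * inner ℝ (p.2 x) e = inner ℝ q.1 Q := fun q => by
    rw [L2.inner_def]
    refine integral_congr_ae ?_
    filter_upwards [hQ] with x hx
    rw [hx, inner_eq_mul]
  have hclosed : IsClosed {q : Pair d | inner ℝ P q.2 = - inner ℝ q.1 Q} :=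
    isClosed_eq (by fun_prop) (by fun_prop)
  rw [e1, e2]
  refine closure_minimal ?_ hclosed hq
  rintro q ⟨φ, hφ, h1, h2⟩
  rw [Set.mem_ofPred_eq, ← e1, ← e2]
  have h := congrArg (fun v : Pt d => inner ℝ e v) (hp.2.2 φ hφ)
  simp only [inner_neg_right] at h
  rw [← integral_inner (integrable_L2_smul (Lp.memLp p.1) (hφ.memLp_gradient 2)),
    ← integral_inner (integrable_L2_smul (hφ.memLp 2) (Lp.memLp p.2))] at h
  convert! h using 1
  · refine integral_congr_ae ?_
    filter_upwards [h2] with x hx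
    rw [hx, real_inner_smul_right, real_inner_comm]
  · congr 1
    refine integral_congr_ae ?_
    filter_upwards [h1] with x hx
    rw [hx, real_inner_smul_right, real_inner_comm]

/-- The weak form of `∇(u²) = 2u∇u` for `u ∈ H¹(U)`. -/
theorem integral_sq_mul_inner_gradient {d : ℕ} {U : Set (Pt d)} (hU : IsOpen U) {p : Pair d}
    (hp : p ∈ H1 U) {η : Pt d → ℝ} (hη : IsTest U η) (e : Pt d) :
    ∫ x, p.1 x * (p.1 x * inner ℝ (gradient η x) e)
      = - 2 * ∫ x, p.1 x * (η x * inner ℝ (p.2 x) e) := by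
  have h := integral_mul_inner_eq_neg hp (hη.mulPair_mem hU hp) e
  have hi : ∀ F : L2Field d, MemLp (fun x => inner ℝ (F x) e) 2 volume := fun F =>
    (Lp.memLp F).inner_const e
  have i1 : Integrable (fun x => p.1 x * (η x * inner ℝ (p.2 x) e)) volume := by
    have := integrable_L2_smul (hη.memLp_smul p.1) (hi p.2)
    refine this.congr (Filter.Eventually.of_forall fun x => ?_)
    simp only [smul_eq_mul]; ring
  have i2 : Integrable (fun x => p.1 x * (p.1 x * inner ℝ (gradient η x) e)) volume := by
    have := integrable_L2_smul (Lp.memLp p.1) ((hη.memLp_smul_gradient p.1).inner_const (𝕜 := ℝ) e)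
    refine this.congr (Filter.Eventually.of_forall fun x => ?_)
    simp only [smul_eq_mul, real_inner_smul_left]
  have e1 : ∫ x, p.1 x * inner ℝ ((hη.mulPair p).2 x) e
      = ∫ x, (p.1 x * (η x * inner ℝ (p.2 x) e)
        + p.1 x * (p.1 x * inner ℝ (gradient η x) e)) := by
    refine integral_congr_ae ?_
    filter_upwards [hη.mulPair_snd p] with x hx
    rw [hx, inner_add_left, real_inner_smul_left, real_inner_smul_left]
    ring
  have e2 : ∫ x, (hη.mulPair p).1 x * inner ℝ (p.2 x) e
      = ∫ x, p.1 x * (η x * inner ℝ (p.2 x) e) := by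
    refine integral_congr_ae ?_
    filter_upwards [hη.mulPair_fst p] with x hx
    rw [hx]
    ring
  rw [e1, e2, integral_add i1 i2] at h
  linarith

/-! ### Cutoff functions on convex sets -/

/-- In a convex set, the distance to the complement grows at least linearly towards the centre `q` of
an inscribed ball. -/
theorem le_infDist_compl_of_convex {d : ℕ} {K : Set (Pt d)} (hK : Convex ℝ K) (hne : Kᶜ.Nonempty)
    {p q : Pt d} {s t : ℝ} (hs : 0 < s) (hq : Metric.ball q s ⊆ K)
    (hp : 0 < Metric.infDist p Kᶜ) (ht0 : 0 ≤ t) (ht1 : t ≤ 1) :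
    (1 - t) * Metric.infDist p Kᶜ + t * s ≤ Metric.infDist (p + t • (q - p)) Kᶜ := by
  set a := Metric.infDist p Kᶜ with ha
  have hpK : Metric.ball p a ⊆ K := by
    have := Metric.disjoint_ball_infDist (x := p) (s := Kᶜ)
    rw [← ha] at this
    exact disjoint_compl_right_iff_subset.1 this
  rw [Metric.le_infDist hne]
  intro y hy
  by_contra h
  rw [not_le, dist_comm] at h
  apply hy
  set R := (1 - t) * a + t * s with hRdef
  have hR : 0 < R := dist_nonneg.trans_lt h
  set w := y - (p + t • (q - p)) with hw
  have hwR : ‖w‖ < R := by rwa [dist_eq_norm] at h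
  have h1 : p + (a / R) • w ∈ K := hpK (by
    rw [Metric.mem_ball, dist_eq_norm, add_sub_cancel_left, norm_smul, Real.norm_eq_abs,
      abs_of_pos (div_pos hp hR), div_mul_eq_mul_div, div_lt_iff₀ hR]
    gcongr)
  have h2 : q + (s / R) • w ∈ K := hq (by
    rw [Metric.mem_ball, dist_eq_norm, add_sub_cancel_left, norm_smul, Real.norm_eq_abs,
      abs_of_pos (div_pos hs hR), div_mul_eq_mul_div, div_lt_iff₀ hR]
    gcongr)
  have h3 := hK h1 h2 (sub_nonneg.2 ht1) ht0 (by ring)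
  have h4 : (1 - t) • (p + (a / R) • w) + t • (q + (s / R) • w) = y := by
    have : (1 - t) * (a / R) + t * (s / R) = 1 := by
      field_simp
      exact hRdef.symm
    calc (1 - t) • (p + (a / R) • w) + t • (q + (s / R) • w)
        = (p + t • (q - p)) + ((1 - t) * (a / R) + t * (s / R)) • w := by module
      _ = y := by rw [this, one_smul, hw]; abel
  rwa [h4] at h3

/-- The function that rises linearly from `0` to `1` while the distance to the complement of `K`
runs from `σ` to `σ + ε`. -/
noncomputable def ramp {d : ℕ} (K : Set (Pt d)) (ε σ : ℝ) (x : Pt d) : ℝ :=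
  max 0 (min 1 ((Metric.infDist x Kᶜ - σ) / ε))

theorem ramp_nonneg {d : ℕ} (K : Set (Pt d)) (ε σ : ℝ) (x : Pt d) : 0 ≤ ramp K ε σ x :=
  le_max_left _ _

theorem ramp_le_one {d : ℕ} (K : Set (Pt d)) (ε σ : ℝ) (x : Pt d) : ramp K ε σ x ≤ 1 :=
  max_le zero_le_one (min_le_left _ _)

theorem ramp_eq_zero {d : ℕ} {K : Set (Pt d)} {ε σ : ℝ} (hε : 0 < ε) {x : Pt d}
    (hx : Metric.infDist x Kᶜ ≤ σ) : ramp K ε σ x = 0 :=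
  max_eq_left ((min_le_right _ _).trans (div_nonpos_of_nonpos_of_nonneg (by linarith) hε.le))

theorem ramp_eq_one {d : ℕ} {K : Set (Pt d)} {ε σ : ℝ} (hε : 0 < ε) {x : Pt d}
    (hx : σ + ε ≤ Metric.infDist x Kᶜ) : ramp K ε σ x = 1 := by
  have : 1 ≤ (Metric.infDist x Kᶜ - σ) / ε := by rw [le_div_iff₀ hε]; linarith
  rw [ramp, min_eq_left this, max_eq_right zero_le_one]

theorem abs_ramp_sub_le {d : ℕ} (K : Set (Pt d)) {ε : ℝ} (hε : 0 < ε) (σ : ℝ) (x y : Pt d) :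
    |ramp K ε σ x - ramp K ε σ y| ≤ ε⁻¹ * dist x y := by
  have h1 : |Metric.infDist x Kᶜ - Metric.infDist y Kᶜ| ≤ dist x y := by
    have := (Metric.lipschitz_infDist_pt (Kᶜ : Set (Pt d))).dist_le_mul x y
    simpa [Real.dist_eq] using this
  set a := (Metric.infDist x Kᶜ - σ) / ε
  set b := (Metric.infDist y Kᶜ - σ) / ε
  have h2 : |a - b| ≤ ε⁻¹ * dist x y := by
    have : a - b = ε⁻¹ * (Metric.infDist x Kᶜ - Metric.infDist y Kᶜ) := by
      simp only [a, b]; field_simp; ring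
    rw [this, abs_mul, abs_of_pos (inv_pos.2 hε)]
    gcongr
  calc |max 0 (min 1 a) - max 0 (min 1 b)| ≤ max |(0 : ℝ) - 0| |min 1 a - min 1 b| :=
        abs_max_sub_max_le_max _ _ _ _
    _ = |min 1 a - min 1 b| := by simp
    _ ≤ max |(1 : ℝ) - 1| |a - b| := abs_min_sub_min_le_max _ _ _ _
    _ = |a - b| := by simp
    _ ≤ _ := h2

theorem continuous_ramp {d : ℕ} (K : Set (Pt d)) (ε σ : ℝ) : Continuous (ramp K ε σ) := by
  unfold ramp
  have := Metric.continuous_infDist_pt (Kᶜ : Set (Pt d))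
  fun_prop

/-- The ramp increases towards the centre of an inscribed ball. -/
theorem ramp_le_ramp_add_smul {d : ℕ} {K : Set (Pt d)} (hK : Convex ℝ K) (hne : Kᶜ.Nonempty)
    {p q : Pt d} {s t ε σ : ℝ} (hε : 0 < ε) (hσ : 0 < σ) (hs : σ + ε ≤ s)
    (hq : Metric.ball q s ⊆ K) (ht0 : 0 ≤ t) (ht1 : t ≤ 1) :
    ramp K ε σ p ≤ ramp K ε σ (p + t • (q - p)) := by
  rcases le_or_gt (Metric.infDist p Kᶜ) σ with h | h
  · rw [ramp_eq_zero hε h]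
    exact ramp_nonneg _ _ _ _
  · have h1 := le_infDist_compl_of_convex hK hne (by linarith) hq (hσ.trans h) ht0 ht1
    rcases le_or_gt s (Metric.infDist p Kᶜ) with h2 | h2
    · rw [ramp_eq_one hε (x := p + t • (q - p))]
      · exact ramp_le_one _ _ _ _
      · nlinarith
    · have h3 : Metric.infDist p Kᶜ ≤ Metric.infDist (p + t • (q - p)) Kᶜ := by nlinarith
      unfold ramp
      gcongr

/-- Inside the boundary layer the ramp increases at rate at least `c / ε` towards the centre of an
inscribed ball. -/
theorem ramp_add_le_ramp_add_smul {d : ℕ} {K : Set (Pt d)} (hK : Convex ℝ K) (hne : Kᶜ.Nonempty)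
    {p q : Pt d} {s t c ε σ : ℝ} (hε : 0 < ε) (hσ : 0 < σ) (hs : 0 < s)
    (hq : Metric.ball q s ⊆ K) (ht0 : 0 ≤ t) (ht1 : t ≤ 1) (hc : 0 ≤ c)
    (h1 : σ ≤ Metric.infDist p Kᶜ) (h2 : Metric.infDist p Kᶜ + t * c ≤ σ + ε)
    (h3 : Metric.infDist p Kᶜ + c ≤ s) :
    ramp K ε σ p + t * (c / ε) ≤ ramp K ε σ (p + t • (q - p)) := by
  have h4 := le_infDist_compl_of_convex hK hne hs hq (hσ.trans_le h1) ht0 ht1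
  have h5 : Metric.infDist p Kᶜ + t * c ≤ Metric.infDist (p + t • (q - p)) Kᶜ := by nlinarith
  have htc : 0 ≤ t * c := mul_nonneg ht0 hc
  have h6 : ramp K ε σ p = (Metric.infDist p Kᶜ - σ) / ε := by
    rw [ramp, min_eq_right, max_eq_right]
    · exact div_nonneg (by linarith) hε.le
    · rw [div_le_one hε]; linarith
  have h7 : ramp K ε σ p + t * (c / ε) = (Metric.infDist p Kᶜ + t * c - σ) / ε := by
    rw [h6]; field_simp; ring
  rw [h7]
  refine le_max_of_le_right (le_min ?_ ?_)
  · rw [div_le_one hε]; linarith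
  · gcongr

theorem le_fderiv_of_forall_add_le {d : ℕ} {χ : Pt d → ℝ} {x v : Pt d} {c t₀ : ℝ}
    (hχ : DifferentiableAt ℝ χ x) (ht₀ : 0 < t₀)
    (h : ∀ t, 0 < t → t < t₀ → χ x + t * c ≤ χ (x + t • v)) : c ≤ fderiv ℝ χ x v := by
  have h1 : HasDerivAt (fun t : ℝ => χ (x + t • v)) (fderiv ℝ χ x v) 0 := by
    have hl : HasDerivAt (fun t : ℝ => x + t • v) v 0 := by
      simpa using ((hasDerivAt_id (0 : ℝ)).smul_const v).const_add x
    refine HasFDerivAt.comp_hasDerivAt (0 : ℝ) ?_ hl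
    simpa using hχ.hasFDerivAt
  have h2 := (hasDerivWithinAt_iff_tendsto_slope' (s := Ioi (0 : ℝ)) (by simp)).1
    (h1.hasDerivWithinAt (s := Ioi 0))
  refine ge_of_tendsto h2 ?_
  filter_upwards [Ioo_mem_nhdsGT ht₀] with t ht
  rw [slope_def_field, sub_zero, le_div_iff₀ ht.1]
  have := h t ht.1 ht.2
  simp only [zero_smul, add_zero]
  linarith

open Convolution in
/-- Smooth cutoff functions of a bounded convex set with an inscribed ball. They increase towards the
centre of the ball, and they do so at rate of order `1 / ε` in a layer of width `ε` that comes
arbitrarily close to the boundary. -/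
theorem exists_cutoff {d : ℕ} {K : Set (Pt d)} (hK : Convex ℝ K)
    (hb : Bornology.IsBounded K) (hne : Kᶜ.Nonempty) {x₀ : Pt d} {r ε σ : ℝ}
    (hr : 0 < r) (hball : Metric.ball x₀ r ⊆ K) (hε : 0 < ε) (hσ : 0 < σ)
    (hεσ : ε + σ ≤ r / 4) :
    ∃ χ : Pt d → ℝ, IsTest K χ ∧ (∀ x, 0 ≤ χ x) ∧ (∀ x, χ x ≤ 1) ∧
      (∀ x, ‖gradient χ x‖ ≤ ε⁻¹) ∧ (∀ x, ε + 2 * σ ≤ Metric.infDist x Kᶜ → χ x = 1) ∧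
      (∀ x, 0 ≤ inner ℝ (gradient χ x) (x₀ - x)) ∧
      ∀ x, 2 * σ ≤ Metric.infDist x Kᶜ → Metric.infDist x Kᶜ ≤ ε →
        r / 2 / ε ≤ inner ℝ (gradient χ x) (x₀ - x) := by
  let b : ContDiffBump (0 : Pt d) := ⟨σ / 4, σ / 2, by positivity, by linarith⟩
  set φ : Pt d → ℝ := b.normed volume
  have hφ : IsTest univ φ := ⟨b.contDiff_normed, b.hasCompactSupport_normed, subset_univ _⟩
  have hφ0 : ∀ y, 0 ≤ φ y := b.nonneg_normed
  have hφ1 : ∫ y, φ y = 1 := b.integral_normed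
  have hφi : Integrable φ volume :=
    hφ.smooth.continuous.integrable_of_hasCompactSupport hφ.compact
  have hsupp : ∀ y, φ y ≠ 0 → ‖y‖ < σ / 2 := fun y hy => by
    simpa using b.support_normed_eq.subset hy
  set h := ramp K ε σ
  have hhc : Continuous h := continuous_ramp K ε σ
  set χ : Pt d → ℝ := φ ⋆[ContinuousLinearMap.lsmul ℝ ℝ, volume] h
  have hχ : ∀ x, χ x = ∫ y, φ y * h (x - y) := fun x => rfl
  have hint : ∀ x, Integrable (fun y => φ y * h (x - y)) volume := fun x =>
    (hφ.smooth.continuous.mul (hhc.comp (by fun_prop))).integrable_of_hasCompactSupport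
      hφ.compact.mul_right
  have hlip : ∀ x y : Pt d,
      |Metric.infDist x Kᶜ - Metric.infDist y Kᶜ| ≤ dist x y := fun x y => by
    simpa [Real.dist_eq] using (Metric.lipschitz_infDist_pt (Kᶜ : Set (Pt d))).dist_le_mul x y
  have hshift : ∀ x y : Pt d, ‖y‖ < σ / 2 →
      |Metric.infDist (x - y) Kᶜ - Metric.infDist x Kᶜ| ≤ σ / 2 := fun x y hy =>
    (hlip _ _).trans (by simpa [dist_eq_norm] using hy.le)
  have hballs : ∀ y : Pt d, ‖y‖ < σ / 2 → Metric.ball (x₀ - y) (r - σ / 2) ⊆ K := fun y hy =>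
    (Metric.ball_subset_ball' (by
      have : dist (x₀ - y) x₀ < σ / 2 := by simpa [dist_eq_norm] using hy
      linarith)).trans hball
  have hpos : ∀ x, 0 < Metric.infDist x Kᶜ → x ∈ K := fun x hx => by
    by_contra hxK
    rw [Metric.infDist_zero_of_mem (show x ∈ Kᶜ from hxK)] at hx
    exact lt_irrefl _ hx
  -- the compact set on which the ramp lives
  set T : Set (Pt d) := {x | σ ≤ Metric.infDist x Kᶜ}
  have hTc : IsCompact T := Metric.isCompact_of_isClosed_isBounded
    (isClosed_le continuous_const (Metric.continuous_infDist_pt _))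
    (hb.subset fun x hx => hpos x (hσ.trans_le hx))
  have hsub : ∀ x, x ∉ Metric.cthickening (σ / 2) T → χ x = 0 := fun x hx =>
    convolution_eq_zero_of_notMem_cthickening
      (Filter.Eventually.of_forall fun x hx => ramp_eq_zero hε (not_le.1 hx).le)
      b.support_normed_eq.subset hx
  have hthick : Metric.cthickening (σ / 2) T ⊆ K := by
    rw [hTc.cthickening_eq_biUnion_closedBall (by positivity)]
    intro x hx
    simp only [mem_iUnion, Metric.mem_closedBall] at hx
    obtain ⟨y, hy, hxy⟩ := hx
    refine hpos x ?_
    have h1 := abs_le.1 (hlip x y)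
    have h2 : σ ≤ Metric.infDist y Kᶜ := hy
    linarith
  have htest : IsTest K χ := by
    refine ⟨hφ.compact.contDiff_convolution_left _ hφ.smooth hhc.locallyIntegrable,
      HasCompactSupport.intro hTc.cthickening hsub, ?_⟩
    refine Subset.trans (closure_minimal (fun x hx => ?_) Metric.isClosed_cthickening) hthick
    by_contra h
    exact hx (hsub x h)
  have hslope : ∀ x : Pt d, ∀ c t : ℝ,
      (∀ y : Pt d, ‖y‖ < σ / 2 → h (x - y) + t * c ≤ h (x - y + t • (x₀ - y - (x - y)))) →
      χ x + t * c ≤ χ (x + t • (x₀ - x)) := by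
    intro x c t hyp
    calc χ x + t * c = ∫ y, (φ y * h (x - y) + φ y * (t * c)) := by
          rw [integral_add (hint x) (hφi.mul_const _), integral_mul_const, hφ1, one_mul, hχ]
      _ ≤ ∫ y, φ y * h (x + t • (x₀ - x) - y) := by
          refine integral_mono ((hint x).add (hφi.mul_const _)) (hint _) fun y => ?_
          by_cases hy : φ y = 0
          · simp [hy]
          · have h1 := hyp y (hsupp y hy)
            have h2 : x - y + t • (x₀ - y - (x - y)) = x + t • (x₀ - x) - y := by
              rw [sub_sub_sub_cancel_right]; abel
            rw [h2] at h1
            simp only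
            rw [← mul_add]
            exact mul_le_mul_of_nonneg_left h1 (hφ0 y)
  refine ⟨χ, htest, fun x => ?_, fun x => ?_, fun x => ?_, fun x hx => ?_, fun x => ?_,
    fun x hx1 hx2 => ?_⟩
  · exact integral_nonneg fun y => mul_nonneg (hφ0 y) (ramp_nonneg _ _ _ _)
  · rw [hχ, ← hφ1]
    exact integral_mono (hint x) hφi fun y => mul_le_of_le_one_right (hφ0 y) (ramp_le_one _ _ _ _)
  · have hL : LipschitzWith (Real.toNNReal ε⁻¹) χ := by
      refine LipschitzWith.of_dist_le_mul fun x x' => ?_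
      rw [Real.coe_toNNReal _ (inv_pos.2 hε).le, Real.dist_eq, hχ, hχ,
        ← integral_sub (hint x) (hint x')]
      calc |∫ y, (φ y * h (x - y) - φ y * h (x' - y))|
          ≤ ∫ y, |φ y * h (x - y) - φ y * h (x' - y)| := abs_integral_le_integral_abs
        _ ≤ ∫ y, φ y * (ε⁻¹ * dist x x') := by
            refine integral_mono ((hint x).sub (hint x')).abs (hφi.mul_const _) fun y => ?_
            simp only
            rw [← mul_sub, abs_mul, abs_of_nonneg (hφ0 y)]
            refine mul_le_mul_of_nonneg_left ?_ (hφ0 y)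
            simpa using abs_ramp_sub_le K hε σ (x - y) (x' - y)
        _ = ε⁻¹ * dist x x' := by rw [integral_mul_const, hφ1, one_mul]
    have := norm_fderiv_le_of_lipschitz ℝ hL (x₀ := x)
    rw [Real.coe_toNNReal _ (inv_pos.2 hε).le] at this
    simpa [gradient] using this
  · rw [hχ, ← hφ1]
    congr 1
    ext y
    by_cases hy : φ y = 0
    · simp [hy]
    · have := abs_le.1 (hshift x y (hsupp y hy))
      have h1 : h (x - y) = 1 := ramp_eq_one hε (by linarith)
      rw [h1, mul_one]
  · rw [inner_gradient]
    refine le_fderiv_of_forall_add_le htest.differentiable.differentiableAt one_pos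
      fun t ht0 ht1 => hslope x 0 t fun y hy => ?_
    rw [mul_zero, add_zero]
    exact ramp_le_ramp_add_smul hK hne hε hσ (by linarith) (hballs y hy) ht0.le ht1.le
  · rw [inner_gradient]
    refine le_fderiv_of_forall_add_le htest.differentiable.differentiableAt
      (t₀ := min 1 (σ / r)) (by positivity) fun t ht0 ht1 => hslope x _ t fun y hy => ?_
    have h1 := abs_le.1 (hshift x y hy)
    have h2 : t * r ≤ σ := by
      have := (ht1.trans_le (min_le_right _ _)).le
      rwa [le_div_iff₀ hr] at this
    exact ramp_add_le_ramp_add_smul hK hne hε hσ (by linarith) (hballs y hy) ht0.le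
      (ht1.trans_le (min_le_left _ _)).le (by positivity) (by linarith) (by linarith) (by linarith)

/-! ### The boundary layer estimate -/

theorem isWeight_of_hasCompactSupport {d : ℕ} {k : Pt d → ℝ} (hk : Continuous k)
    (hs : HasCompactSupport k) : IsWeight k := by
  obtain ⟨c, hc⟩ := hs.exists_bound_of_continuous hk
  exact ⟨hk.measurable, c, hc⟩

theorem inner_eq_sum {d : ℕ} (v w : Pt d) :
    inner ℝ v w = ∑ k, w k * inner ℝ v (EuclideanSpace.single k (1 : ℝ)) := by
  rw [PiLp.inner_apply]
  refine Finset.sum_congr rfl fun k _ => ?_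
  rw [EuclideanSpace.inner_single_right, inner_eq_mul]
  simp [mul_comm]

theorem integrable_mul_norm {d : ℕ} (p : Pair d) :
    Integrable (fun x => |p.1 x| * ‖p.2 x‖) volume :=
  integrable_L2_smul (Lp.memLp p.1).norm (Lp.memLp p.2).norm

/-- The weak form of `div (u² χ (x - x₀)) = u² ∇χ · (x - x₀) + d χ u² + 2 χ u ∇u · (x - x₀)`. -/
theorem integral_sq_mul_inner_sub {d : ℕ} {U : Set (Pt d)} (hU : IsOpen U) {p : Pair d}
    (hp : p ∈ H1 U) {χ : Pt d → ℝ} (hχ : IsTest U χ) (x₀ : Pt d) :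
    ∫ x, inner ℝ (gradient χ x) (x₀ - x) * (p.1 x * p.1 x)
      = d * (∫ x, χ x * (p.1 x * p.1 x))
        + 2 * ∫ x, p.1 x * (χ x * inner ℝ (p.2 x) (x - x₀)) := by
  let e : Fin d → Pt d := fun k => EuclideanSpace.single k (1 : ℝ)
  -- the components of the vector field `χ (x - x₀)`
  let η : Fin d → Pt d → ℝ := fun k x => χ x * (x k - x₀ k)
  have hsm : ∀ k, ContDiff ℝ ∞ (fun x : Pt d => x k - x₀ k) := fun k =>
    (contDiff_euclidean.1 contDiff_id k).sub contDiff_const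
  have hη : ∀ k, IsTest U (η k) := fun k => hχ.mul_left (hsm k)
  have hgrad : ∀ k x, inner ℝ (gradient (η k) x) (e k)
      = (x k - x₀ k) * inner ℝ (gradient χ x) (e k) + χ x := by
    intro k x
    have hd : Differentiable ℝ (fun x : Pt d => x k - x₀ k) := (hsm k).differentiable (by simp)
    rw [gradient_mul_of_differentiable hχ.differentiable hd, inner_add_left, real_inner_smul_left,
      real_inner_smul_left, inner_gradient (fun x : Pt d => x k - x₀ k)]
    have h1 : HasFDerivAt (fun x : Pt d => x k - x₀ k) (EuclideanSpace.proj k : Pt d →L[ℝ] ℝ) x :=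
      (EuclideanSpace.proj k : Pt d →L[ℝ] ℝ).hasFDerivAt.sub_const _
    rw [h1.fderiv]
    simp [e]
    ring
  have hw1 : IsWeight (fun x => inner ℝ (gradient χ x) (x₀ - x)) :=
    isWeight_of_hasCompactSupport
      (hχ.continuous_gradient.inner (continuous_const.sub continuous_id)) (by
        refine hχ.gradient_compact.mono fun x hx h => hx ?_
        simp [h])
  have hw2 : IsWeight χ := isWeight_of_hasCompactSupport hχ.smooth.continuous hχ.compact
  have i1 : Integrable (fun x => inner ℝ (gradient χ x) (x₀ - x) * (p.1 x * p.1 x)) volume := by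
    simpa only [inner_eq_mul] using hw1.integrable_inner p.1 p.1
  have i2 : Integrable (fun x => χ x * (p.1 x * p.1 x)) volume := by
    simpa only [inner_eq_mul] using hw2.integrable_inner p.1 p.1
  have hwk : ∀ k, IsWeight (fun x => inner ℝ (gradient (η k) x) (e k)) := fun k =>
    isWeight_of_hasCompactSupport ((hη k).continuous_gradient.inner continuous_const) (by
      refine (hη k).gradient_compact.mono fun x hx h => hx ?_
      simp [h])
  have i3 : ∀ k, Integrable (fun x => p.1 x * (p.1 x * inner ℝ (gradient (η k) x) (e k)))
      volume := fun k => by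
    have := (hwk k).integrable_inner p.1 p.1
    refine this.congr (Filter.Eventually.of_forall fun x => ?_)
    simp only [inner_eq_mul]; ring
  have i4 : ∀ k, Integrable (fun x => p.1 x * (η k x * inner ℝ (p.2 x) (e k))) volume := fun k => by
    have := integrable_L2_smul ((hη k).memLp_smul p.1)
      ((Lp.memLp p.2).inner_const (𝕜 := ℝ) (e k))
    refine this.congr (Filter.Eventually.of_forall fun x => ?_)
    simp only [smul_eq_mul]; ring
  have hsum : ∑ k, ∫ x, p.1 x * (p.1 x * inner ℝ (gradient (η k) x) (e k))
      = - 2 * ∑ k, ∫ x, p.1 x * (η k x * inner ℝ (p.2 x) (e k)) := by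
    rw [Finset.mul_sum]
    exact Finset.sum_congr rfl fun k _ => integral_sq_mul_inner_gradient hU hp (hη k) (e k)
  rw [← integral_finsetSum _ fun k _ => i3 k, ← integral_finsetSum _ fun k _ => i4 k] at hsum
  have e1 : ∫ x, ∑ k, p.1 x * (p.1 x * inner ℝ (gradient (η k) x) (e k))
      = ∫ x, (d * (χ x * (p.1 x * p.1 x))
        - inner ℝ (gradient χ x) (x₀ - x) * (p.1 x * p.1 x)) := by
    refine integral_congr_ae (Filter.Eventually.of_forall fun x => ?_)
    simp only [hgrad]
    rw [inner_eq_sum (gradient χ x) (x₀ - x)]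
    simp only [mul_add, Finset.sum_add_distrib, Finset.sum_mul, Finset.sum_const,
      Finset.card_univ, Fintype.card_fin, nsmul_eq_mul]
    rw [add_comm, sub_eq_add_neg, ← Finset.sum_neg_distrib]
    congr 1
    · ring
    · refine Finset.sum_congr rfl fun k _ => ?_
      simp only [PiLp.sub_apply, e]
      ring
  have e2 : ∫ x, ∑ k, p.1 x * (η k x * inner ℝ (p.2 x) (e k))
      = ∫ x, p.1 x * (χ x * inner ℝ (p.2 x) (x - x₀)) := by
    refine integral_congr_ae (Filter.Eventually.of_forall fun x => ?_)
    simp only [η, e]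
    rw [inner_eq_sum (p.2 x) (x - x₀), Finset.mul_sum, Finset.mul_sum]
    refine Finset.sum_congr rfl fun k _ => ?_
    simp only [PiLp.sub_apply]
    ring
  rw [e1, e2, integral_sub (i2.const_mul _) i1, integral_const_mul] at hsum
  linarith

/-- In a convex set, the mass of an `H¹` function in a boundary layer of width `ε` is `O(ε)`. -/
theorem setIntegral_layer_le {d : ℕ} {K : Set (Pt d)} (hKo : IsOpen K) (hK : Convex ℝ K)
    (hb : Bornology.IsBounded K) (hne : Kᶜ.Nonempty) {x₀ : Pt d} {r R b ε : ℝ}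
    (hr : 0 < r) (hball : Metric.ball x₀ r ⊆ K) (hR : ∀ x ∈ K, ‖x - x₀‖ ≤ R) (hb0 : 0 < b)
    (hε : 0 < ε) (hεr : ε ≤ r / 8) {p : Pair d} (hp : p ∈ H1 K) :
    r / 2 / ε * ∫ x in {x | 0 < Metric.infDist x Kᶜ ∧ Metric.infDist x Kᶜ ≤ ε}, p.1 x * p.1 x
      ≤ (d + R / b) * (∫ x, p.1 x * p.1 x) + R * b * ∫ x, inner ℝ (p.2 x) (p.2 x) := by
  set ρ : Pt d → ℝ := fun x => Metric.infDist x Kᶜ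
  have hρ : Continuous ρ := Metric.continuous_infDist_pt _
  have hR0 : 0 ≤ R := (norm_nonneg _).trans (hR x₀ (hball (Metric.mem_ball_self hr)))
  have iu : Integrable (fun x => p.1 x * p.1 x) volume := integrable_L2_mul p.1 p.1
  have ig : Integrable (fun x => inner ℝ (p.2 x) (p.2 x)) volume := L2.integrable_inner p.2 p.2
  set M := (d + R / b) * (∫ x, p.1 x * p.1 x) + R * b * ∫ x, inner ℝ (p.2 x) (p.2 x) with hM
  let A : ℕ → Set (Pt d) := fun n => {x | ε / (n + 1) ≤ ρ x ∧ ρ x ≤ ε}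
  have hAm : ∀ n, MeasurableSet (A n) := fun n =>
    ((isClosed_le continuous_const hρ).inter (isClosed_le hρ continuous_const)).measurableSet
  have hmono : Monotone A := fun m n hmn x hx => by
    refine ⟨le_trans ?_ hx.1, hx.2⟩
    gcongr
  have hunion : ⋃ n, A n = {x | 0 < ρ x ∧ ρ x ≤ ε} := by
    ext x
    simp only [mem_iUnion]
    constructor
    · rintro ⟨n, h1, h2⟩
      exact ⟨lt_of_lt_of_le (by positivity) h1, h2⟩
    · rintro ⟨h1, h2⟩
      obtain ⟨n, hn⟩ := exists_nat_one_div_lt (div_pos h1 hε)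
      refine ⟨n, ?_, h2⟩
      rw [lt_div_iff₀ hε, one_div_mul_eq_div] at hn
      exact hn.le
  have key : ∀ n, r / 2 / ε * ∫ x in A n, p.1 x * p.1 x ≤ M := by
    intro n
    -- the cutoff function controls the part of the layer where the distance is at least `2 σ`
    set σ : ℝ := ε / (n + 1) / 2 with hσdef
    have hσ : 0 < σ := by positivity
    have hσε : 2 * σ ≤ ε := by
      have : ε / (n + 1) ≤ ε := div_le_self hε.le (by linarith [n.cast_nonneg (α := ℝ)])
      linarith
    obtain ⟨χ, hχ, h0, h1, -, -, hnn, hlayer⟩ :=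
      exists_cutoff hK hb hne hr hball hε hσ (by linarith)
    have hid := integral_sq_mul_inner_sub hKo hp hχ x₀
    have hw1 : IsWeight (fun x => inner ℝ (gradient χ x) (x₀ - x)) :=
      isWeight_of_hasCompactSupport
        (hχ.continuous_gradient.inner (continuous_const.sub continuous_id)) (by
          refine hχ.gradient_compact.mono fun x hx h => hx ?_
          simp [h])
    have hw2 : IsWeight χ := isWeight_of_hasCompactSupport hχ.smooth.continuous hχ.compact
    have i1 : Integrable (fun x => inner ℝ (gradient χ x) (x₀ - x) * (p.1 x * p.1 x)) volume := by
      simpa only [inner_eq_mul] using hw1.integrable_inner p.1 p.1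
    have i2 : Integrable (fun x => χ x * (p.1 x * p.1 x)) volume := by
      simpa only [inner_eq_mul] using hw2.integrable_inner p.1 p.1
    have b1 : r / 2 / ε * ∫ x in A n, p.1 x * p.1 x
        ≤ ∫ x, inner ℝ (gradient χ x) (x₀ - x) * (p.1 x * p.1 x) := by
      rw [← integral_const_mul]
      calc ∫ x in A n, r / 2 / ε * (p.1 x * p.1 x)
          ≤ ∫ x in A n, inner ℝ (gradient χ x) (x₀ - x) * (p.1 x * p.1 x) := by
            refine setIntegral_mono_on (iu.const_mul _).integrableOn i1.integrableOn (hAm n)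
              fun x hx => ?_
            refine mul_le_mul_of_nonneg_right (hlayer x ?_ hx.2) (mul_self_nonneg _)
            have := hx.1
            linarith
        _ ≤ _ := setIntegral_le_integral i1
            (Filter.Eventually.of_forall fun x => mul_nonneg (hnn x) (mul_self_nonneg _))
    have b2 : ∫ x, χ x * (p.1 x * p.1 x) ≤ ∫ x, p.1 x * p.1 x :=
      integral_mono i2 iu fun x => mul_le_of_le_one_left (mul_self_nonneg _) (h1 x)
    have hpt : ∀ x, |p.1 x * (χ x * inner ℝ (p.2 x) (x - x₀))| ≤ R * (|p.1 x| * ‖p.2 x‖) := by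
      intro x
      by_cases hx : x ∈ K
      · rw [abs_mul, abs_mul, abs_of_nonneg (h0 x)]
        have h2 : |inner ℝ (p.2 x) (x - x₀)| ≤ ‖p.2 x‖ * R :=
          (abs_real_inner_le_norm _ _).trans (by gcongr; exact hR x hx)
        calc |p.1 x| * (χ x * |inner ℝ (p.2 x) (x - x₀)|)
            ≤ |p.1 x| * (1 * (‖p.2 x‖ * R)) := by
              gcongr
              exact h1 x
          _ = R * (|p.1 x| * ‖p.2 x‖) := by ring
      · rw [image_eq_zero_of_notMem_tsupport fun h => hx (hχ.subset h), zero_mul, mul_zero, abs_zero]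
        positivity
    have i3 : Integrable (fun x => p.1 x * (χ x * inner ℝ (p.2 x) (x - x₀))) volume := by
      refine ((integrable_mul_norm p).const_mul R).mono' ?_ (Filter.Eventually.of_forall hpt)
      exact (Lp.aestronglyMeasurable p.1).mul (hχ.smooth.continuous.aestronglyMeasurable.mul
        ((Lp.aestronglyMeasurable p.2).inner
          (continuous_id.sub continuous_const).aestronglyMeasurable))
    have b3 : ∫ x, p.1 x * (χ x * inner ℝ (p.2 x) (x - x₀))
        ≤ ∫ x, (R / (2 * b) * (p.1 x * p.1 x) + R * b / 2 * inner ℝ (p.2 x) (p.2 x)) := by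
      refine integral_mono i3 ((iu.const_mul _).add (ig.const_mul _)) fun x => ?_
      refine ((le_abs_self _).trans (hpt x)).trans ?_
      simp only [real_inner_self_eq_norm_sq, ← abs_mul_abs_self (p.1 x)]
      -- the inequality `2 s t ≤ s² / b + b t²`
      have h2 : R / (2 * b) * (|p.1 x| * |p.1 x|) + R * b / 2 * ‖p.2 x‖ ^ 2
          - R * (|p.1 x| * ‖p.2 x‖) = R / (2 * b) * (|p.1 x| - b * ‖p.2 x‖) ^ 2 := by
        field_simp
        ring
      have h3 : 0 ≤ R / (2 * b) * (|p.1 x| - b * ‖p.2 x‖) ^ 2 := by positivity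
      linarith
    rw [integral_add (iu.const_mul _) (ig.const_mul _), integral_const_mul, integral_const_mul] at b3
    have b4 : (d : ℝ) * ∫ x, χ x * (p.1 x * p.1 x) ≤ d * ∫ x, p.1 x * p.1 x := by gcongr
    have b5 : R / b = 2 * (R / (2 * b)) := by field_simp
    rw [hM, b5]
    linarith
  rw [← hunion]
  refine le_of_tendsto' ((tendsto_setIntegral_of_monotone hAm hmono iu.integrableOn).const_mul _) key

/-! ### Geometry of a coarse element -/

namespace Setup

variable {d : ℕ} (S : Setup d)

theorem norm_sub_le_of_mem {i : Fin S.N} {x y : Pt d} (hx : x ∈ S.K i) (hy : y ∈ S.K i) :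
    ‖x - y‖ ≤ √d * S.H := by
  rw [EuclideanSpace.norm_eq, ← Real.sqrt_sq S.H_pos.le, ← Real.sqrt_mul (Nat.cast_nonneg d)]
  apply Real.sqrt_le_sqrt
  calc ∑ k, ‖(x - y) k‖ ^ 2 ≤ ∑ _k : Fin d, S.H ^ 2 := by
        refine Finset.sum_le_sum fun k _ => ?_
        have := S.K_size i x hx y hy k
        rw [PiLp.sub_apply, Real.norm_eq_abs]
        gcongr
    _ = d * S.H ^ 2 := by simp

theorem isBounded_K (i : Fin S.N) : Bornology.IsBounded (S.K i) := by
  rw [Metric.isBounded_iff]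
  exact ⟨_, fun x hx y hy => by rw [dist_eq_norm]; exact S.norm_sub_le_of_mem hx hy⟩

theorem nonempty_compl_K (hd : 0 < d) (i : Fin S.N) : (S.K i)ᶜ.Nonempty := by
  rw [nonempty_compl]
  intro h
  have := S.K_size i (EuclideanSpace.single ⟨0, hd⟩ (2 * S.H)) (by simp [h]) 0 (by simp [h])
    ⟨0, hd⟩
  have hH := S.H_pos
  simp only [PiLp.single_apply, if_true, PiLp.zero_apply, sub_zero] at this
  rw [abs_of_pos (by linarith)] at this
  linarith

/-- A bubble function with gradient bounded by `D / H` yields an inscribed ball of radius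
`H / (2 D)`. -/
theorem IsBubble.exists_ball_subset {S : Setup d} {D : ℝ} {B : Fin S.N → Pt d → ℝ}
    (hB : S.IsBubble D B) (i : Fin S.N) :
    ∃ x₀, Metric.ball x₀ (S.H / (2 * max D 1)) ⊆ S.K i := by
  obtain ⟨x₀, hx₀⟩ := hB.attains i
  refine ⟨x₀, fun x hx => ?_⟩
  have hH := S.H_pos
  -- the maximum with `1` keeps the radius positive without a sign condition on `D`
  have hD : 0 < max D 1 := lt_max_of_lt_right one_pos
  rw [Metric.mem_ball, dist_eq_norm, lt_div_iff₀ (by positivity)] at hx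
  have h1 : ‖B i x - B i x₀‖ ≤ max D 1 * S.H⁻¹ * ‖x - x₀‖ := by
    refine Convex.norm_image_sub_le_of_norm_fderiv_le (𝕜 := ℝ) (s := univ)
      (fun y _ => (hB.test i).differentiable y) (fun y _ => ?_) convex_univ (mem_univ _) (mem_univ _)
    have h2 : ‖gradient (B i) y‖ ≤ max D 1 * S.H⁻¹ :=
      (hB.grad i y).trans (by gcongr; exact le_max_left _ _)
    simpa [gradient] using h2
  have h3 : max D 1 * S.H⁻¹ * ‖x - x₀‖ < 1 := by
    rw [mul_right_comm, ← div_eq_mul_inv, div_lt_one hH]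
    nlinarith [norm_nonneg (x - x₀)]
  rw [hx₀, Real.norm_eq_abs] at h1
  have h4 : B i x ≠ 0 := by
    intro h
    rw [h] at h1
    norm_num at h1
    linarith
  exact (hB.test i).subset (subset_tsupport _ h4)

/-- The bound `G` in `|∇χ| ≤ G / H` for the cutoff functions `χ` that preserve half of the mass of
the functions with energy at most `E / H²` times their mass. -/
noncomputable def cutoffConst (d : ℕ) (D E : ℝ) : ℝ := 32 * (d + √d + √d * E + 1) * max D 1

/-- Functions of bounded energy do not concentrate near the boundary of a coarse element, so that
some cutoff function preserves half of their mass. -/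
theorem exists_mass_preserving_cutoff (hd : 0 < d) {D E : ℝ} (hE : 0 ≤ E)
    {B : Fin S.N → Pt d → ℝ} (hB : S.IsBubble D B) (i : Fin S.N) :
    ∃ χ : Pt d → ℝ, IsTest (S.K i) χ ∧ (∀ x, 0 ≤ χ x) ∧ (∀ x, χ x ≤ 1) ∧
      (∀ x, ‖gradient χ x‖ ≤ cutoffConst d D E * S.H⁻¹) ∧
      ∀ p ∈ H1 (S.K i), S.H ^ 2 * (∫ x, inner ℝ (p.2 x) (p.2 x)) ≤ E * ∫ x, p.1 x * p.1 x →
        (∫ x, p.1 x * p.1 x) / 2 ≤ ∫ x, χ x * (p.1 x * p.1 x) := by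
  obtain ⟨x₀, hball⟩ := hB.exists_ball_subset i
  have hH := S.H_pos
  have hD : 0 < max D 1 := lt_max_of_lt_right one_pos
  set r := S.H / (2 * max D 1) with hr
  have hr0 : 0 < r := by positivity
  set M := d + √d + √d * E + 1 with hM
  have hM1 : 1 ≤ M := by
    have : 0 ≤ (d : ℝ) + √d + √d * E := by positivity
    linarith
  have hM0 : 0 < M := by linarith
  -- the layer estimate has the form `mass of the layer ≤ (2 ε / r) M * mass`, which this width
  -- turns into a quarter of the mass
  set ε := r / (8 * M) with hε
  have hε0 : 0 < ε := by positivity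
  have hεr : ε ≤ r / 8 := by
    rw [hε]
    gcongr
    linarith
  have hne := S.nonempty_compl_K hd i
  have hb := S.isBounded_K i
  have hx₀ : x₀ ∈ S.K i := hball (Metric.mem_ball_self hr0)
  obtain ⟨χ, hχ, h0, h1, hgrad, hone, -, -⟩ :=
    exists_cutoff (S.K_convex i) hb hne hr0 hball (half_pos hε0) (σ := ε / 4) (by positivity)
      (by linarith)
  refine ⟨χ, hχ, h0, h1, fun x => (hgrad x).trans (le_of_eq ?_), fun p hp hpE => ?_⟩
  · rw [cutoffConst, ← hM, hε, hr]
    field_simp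
    norm_num
  · have hlayer := setIntegral_layer_le (S.K_open i) (S.K_convex i) hb hne hr0 hball
      (fun x hx => S.norm_sub_le_of_mem hx hx₀) hH hε0 hεr hp
    set A : Set (Pt d) :=
      {x | 0 < Metric.infDist x (S.K i)ᶜ ∧ Metric.infDist x (S.K i)ᶜ ≤ ε}
    have hρ := Metric.continuous_infDist_pt ((S.K i)ᶜ)
    have hAm : MeasurableSet A := ((isOpen_lt continuous_const hρ).measurableSet).inter
      (isClosed_le hρ continuous_const).measurableSet
    set Z := ∫ x, p.1 x * p.1 x with hZ
    have hZ0 : 0 ≤ Z := integral_nonneg fun x => mul_self_nonneg _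
    have iu : Integrable (fun x => p.1 x * p.1 x) volume := integrable_L2_mul p.1 p.1
    have h2 : r / 2 / ε * ∫ x in A, p.1 x * p.1 x ≤ M * Z := by
      refine hlayer.trans ?_
      have e1 : √d * S.H / S.H = √(d : ℝ) := by field_simp
      have e2 : √d * (S.H ^ 2 * ∫ x, inner ℝ (p.2 x) (p.2 x)) ≤ √d * (E * Z) := by gcongr
      rw [e1, hM]
      nlinarith
    have h3 : ∫ x in A, p.1 x * p.1 x ≤ Z / 4 := by
      have e1 : r / 2 / ε = 4 * M := by
        rw [hε]
        field_simp
        norm_num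
      rw [e1] at h2
      nlinarith
    have hw : IsWeight χ := isWeight_of_hasCompactSupport hχ.smooth.continuous hχ.compact
    have iχ : Integrable (fun x => χ x * (p.1 x * p.1 x)) volume := by
      simpa only [inner_eq_mul] using hw.integrable_inner p.1 p.1
    have h4 : Z - ∫ x, χ x * (p.1 x * p.1 x) ≤ ∫ x in A, p.1 x * p.1 x := by
      rw [hZ, ← integral_sub iu iχ, ← integral_indicator hAm]
      refine integral_mono_ae (iu.sub iχ) (iu.indicator hAm) ?_
      filter_upwards [hp.1] with x hx
      by_cases hxA : x ∈ A
      · rw [indicator_of_mem hxA]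
        have := mul_nonneg (h0 x) (mul_self_nonneg (p.1 x))
        linarith
      · rw [indicator_of_notMem hxA]
        by_cases hxK : x ∈ S.K i
        · have hpos : 0 < Metric.infDist x (S.K i)ᶜ :=
            ((S.K_open i).isClosed_compl.notMem_iff_infDist_pos hne).1 (not_not.2 hxK)
          have hlarge : ε ≤ Metric.infDist x (S.K i)ᶜ := by
            by_contra h
            exact hxA ⟨hpos, (not_le.1 h).le⟩
          rw [hone x (by linarith), one_mul, sub_self]
        · simp [hx hxK]
    linarith

end Setup

/-! ### Spans of eigenfunctions -/

/-- A combination of eigenfunctions with eigenvalues at most `E` has Rayleigh quotient at most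
`E`. -/
theorem IsFirstEigen.form_sum_le {d : ℕ} {X : Set (Pair d)} {A M : Pair d → Pair d → ℝ} {n : ℕ}
    {ξ : Fin n → Pair d} {l : Fin n → ℝ} (h : IsFirstEigen X A M ξ l) {E : ℝ} (hl : ∀ j, l j ≤ E)
    (A' M' : Pair d →ₗ[ℝ] Pair d →ₗ[ℝ] ℝ) (hA : ∀ u v, A u v = A' u v)
    (hM : ∀ u v, M u v = M' u v) (c : Fin n → ℝ) :
    A (∑ j, c j • ξ j) (∑ j, c j • ξ j) ≤ E * M (∑ j, c j • ξ j) (∑ j, c j • ξ j) := by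
  have hMjk : ∀ j k, M' (ξ j) (ξ k) = if j = k then 1 else 0 := fun j k => by
    rw [← hM, h.orthonormal]
  have hAjk : ∀ j k, A' (ξ j) (ξ k) = if j = k then l j else 0 := fun j k => by
    rw [← hA, (h.eigen j).2.2 _ (h.eigen k).1, hM, hMjk]
    simp
  rw [hA, hM]
  simp only [map_sum, LinearMap.sum_apply, map_smul, LinearMap.smul_apply, hMjk, hAjk, smul_eq_mul,
    mul_ite, mul_one, mul_zero, Finset.sum_ite_eq', Finset.mem_univ, if_true]
  rw [Finset.mul_sum]
  refine Finset.sum_le_sum fun j _ => ?_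
  nlinarith [mul_nonneg (mul_self_nonneg (c j)) (sub_nonneg.2 (hl j))]

theorem exists_sum_eq_of_mem_auxSpace {d N : ℕ} {n : Fin N → ℕ} {ξ : ∀ i, Fin (n i) → Pair d}
    {μ : L2 d} (hμ : μ ∈ auxSpace ξ) :
    ∃ c : ∀ i, Fin (n i) → ℝ, μ = ∑ i, (∑ j, c i j • ξ i j).1 := by
  have hset : {u | ∃ i, ∃ j, u = (ξ i j).1}
      = range fun k : (Σ i, Fin (n i)) => (ξ k.1 k.2).1 := by
    ext u
    constructor
    · rintro ⟨i, j, rfl⟩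
      exact ⟨⟨i, j⟩, rfl⟩
    · rintro ⟨⟨i, j⟩, rfl⟩
      exact ⟨i, j, rfl⟩
  rw [auxSpace, hset, Submodule.mem_span_range_iff_exists_fun] at hμ
  obtain ⟨c, rfl⟩ := hμ
  refine ⟨fun i j => c ⟨i, j⟩, ?_⟩
  rw [Fintype.sum_sigma]
  refine Finset.sum_congr rfl fun i _ => ?_
  rw [Prod.fst_sum]
  rfl

theorem fst_sum_mem_auxSpace {d N : ℕ} {n : Fin N → ℕ} (ξ : ∀ i, Fin (n i) → Pair d) (i : Fin N)
    (c : Fin (n i) → ℝ) : (∑ j, c j • ξ i j).1 ∈ auxSpace ξ := by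
  rw [Prod.fst_sum]
  exact Submodule.sum_mem _ fun j _ => Submodule.smul_mem _ _ (Submodule.subset_span ⟨i, j, rfl⟩)

namespace Setup

variable {d : ℕ} (S : Setup d)

/-! ### Functions carried by single coarse elements -/

theorem notMem_K_of_mem {i k : Fin S.N} (hik : i ≠ k) {x : Pt d} (hx : x ∈ S.K i) : x ∉ S.K k :=
  fun hk => Set.disjoint_left.1 (S.K_disjoint hik) hx hk

theorem ae_sum_eq_of_mem_K {y : Fin S.N → L2 d} (hy : ∀ i, ∀ᵐ x, x ∉ S.K i → y i x = 0)
    (i : Fin S.N) : ∀ᵐ x, x ∈ S.K i → (∑ k, y k) x = y i x := by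
  filter_upwards [Lp.coeFn_finsetSum Finset.univ y, ae_all_iff.2 hy] with x hx hy hxi
  rw [hx, Finset.sum_apply]
  refine Finset.sum_eq_single i (fun k _ hki => ?_) (by simp)
  exact hy k (S.notMem_K_of_mem hki.symm hxi)

theorem norm_sum_sq_eq {y : Fin S.N → L2 d} (hy : ∀ i, ∀ᵐ x, x ∉ S.K i → y i x = 0) :
    ‖∑ k, y k‖ ^ 2 = ∑ k, ∫ x, y k x * y k x := by
  rw [← real_inner_self_eq_norm_sq, sum_inner]
  refine Finset.sum_congr rfl fun k _ => ?_
  rw [L2.inner_def]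
  refine integral_congr_ae ?_
  filter_upwards [hy k, S.ae_sum_eq_of_mem_K hy k] with x h1 h2
  by_cases hx : x ∈ S.K k
  · rw [h2 hx, inner_eq_mul]
  · rw [h1 hx, inner_zero_left, zero_mul]

/-- If one of the two functions is supported in `K_i` and vanishes on the high-contrast region, the
form `s_i` is `H⁻²` times the `L²` inner product. -/
theorem sLoc_eq_of_vanish (i : Fin S.N) (u w : L2 d) (hw : ∀ᵐ x, x ∉ S.K i → w x = 0)
    (hw' : ∀ᵐ x, x ∈ S.OmK → w x = 0) :
    S.sLoc i u w = (S.H ^ 2)⁻¹ * ∫ x, u x * w x := by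
  rw [sLoc, setIntegral_eq_integral_of_ae_compl_eq_zero, ← integral_const_mul]
  · refine integral_congr_ae ?_
    filter_upwards [hw'] with x hx
    by_cases hO : x ∈ S.OmK
    · rw [hx hO]; ring
    · rw [kappa, if_neg hO, mul_one]
  · filter_upwards [hw] with x hx hxi
    rw [hx hxi, mul_zero, mul_zero]

theorem s_eq_of_vanish (i : Fin S.N) (u w : L2 d) (hw : ∀ᵐ x, x ∉ S.K i → w x = 0)
    (hw' : ∀ᵐ x, x ∈ S.OmK → w x = 0) :
    S.s u w = (S.H ^ 2)⁻¹ * ∫ x, u x * w x := by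
  rw [← S.sLoc_eq_of_vanish i u w hw hw']
  refine Finset.sum_eq_single i (fun k _ hki => ?_) (by simp)
  refine setIntegral_eq_zero_of_ae_eq_zero ?_
  filter_upwards [hw] with x hx hxk
  rw [hx (S.notMem_K_of_mem hki hxk), mul_zero, mul_zero]

theorem l2_eq_of_vanish (i : Fin S.N) (u w : L2 d) (hw : ∀ᵐ x, x ∉ S.K i → w x = 0) :
    S.l2 u w = ∫ x, u x * w x := by
  refine setIntegral_eq_integral_of_ae_compl_eq_zero ?_
  filter_upwards [hw] with x hx hxO
  rw [hx fun h => hxO (S.K_subset i h), mul_zero]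

theorem a_eq_aLoc_of_vanish (i : Fin S.N) (v w : Pair d) (hw : ∀ᵐ x, x ∉ S.K i → w.2 x = 0) :
    S.a v w = S.aLoc i v w := by
  rw [a, aLoc, setIntegral_eq_integral_of_ae_compl_eq_zero,
    setIntegral_eq_integral_of_ae_compl_eq_zero]
  · filter_upwards [hw] with x hx hxi
    rw [hx hxi, inner_zero_right, mul_zero]
  · filter_upwards [hw] with x hx hxO
    rw [hx fun h => hxO (S.K_subset i h), inner_zero_right, mul_zero]

theorem sum_aLoc_le_a (v : Pair d) : ∑ i, S.aLoc i v v ≤ S.a v v := by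
  have hint := S.isWeight_kappa.integrable_inner v.2 v.2
  unfold aLoc a
  rw [← integral_biUnion_finset Finset.univ (fun i _ => S.K_meas i)
    (fun i _ j _ hij => S.K_disjoint hij) (fun i _ => hint.integrableOn)]
  refine setIntegral_mono_set hint.integrableOn
    (Filter.Eventually.of_forall fun x => mul_nonneg (S.kappa_nonneg x) real_inner_self_nonneg) ?_
  exact LE.le.eventuallyLE (by simpa using S.K_subset)

theorem aLoc_self_nonneg (i : Fin S.N) (v : Pair d) : 0 ≤ S.aLoc i v v := by
  rw [aLoc_eq]
  exact weightedForm_self_nonneg _ S.kappa_nonneg _ _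

theorem aLoc_sq_le (i : Fin S.N) (v w : Pair d) :
    S.aLoc i v w ^ 2 ≤ S.aLoc i v v * S.aLoc i w w := by
  simp only [aLoc_eq]
  exact weightedForm_sq_le _ S.kappa_nonneg _ _ _

theorem aLoc_add_self_le (i : Fin S.N) (v w : Pair d) :
    S.aLoc i (v + w) (v + w) ≤ 2 * S.aLoc i v v + 2 * S.aLoc i w w := by
  have h := S.aLoc_self_nonneg i (v - w)
  simp only [aLoc_eq, Prod.snd_sub, Prod.snd_add, map_sub, map_add, LinearMap.sub_apply,
    LinearMap.add_apply] at h ⊢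
  linarith

theorem integral_inner_le_aLoc (i : Fin S.N) {p : Pair d} (hp : ∀ᵐ x, x ∉ S.K i → p.2 x = 0) :
    ∫ x, inner ℝ (p.2 x) (p.2 x) ≤ S.aLoc i p p := by
  rw [aLoc, setIntegral_eq_integral_of_ae_compl_eq_zero]
  · refine integral_mono (L2.integrable_inner p.2 p.2)
      (S.isWeight_kappa.integrable_inner p.2 p.2) fun x => ?_
    exact le_mul_of_one_le_left real_inner_self_nonneg (S.one_le_kappa x)
  · filter_upwards [hp] with x hx hxi
    rw [hx hxi, inner_zero_right, mul_zero]

/-- The energy of a function cut off inside `K_i`. The coefficient does not enter the term with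
`∇χ`, since the function vanishes on the high-contrast region. -/
theorem aLoc_mulPair_le (i : Fin S.N) {p : Pair d} (hp : p ∈ S.Vk i) {χ : Pt d → ℝ}
    (hχ : IsTest (S.K i) χ) (h0 : ∀ x, 0 ≤ χ x) (h1 : ∀ x, χ x ≤ 1) {g : ℝ}
    (hg : ∀ x, ‖gradient χ x‖ ≤ g) :
    S.aLoc i (hχ.mulPair p) (hχ.mulPair p)
      ≤ 2 * S.aLoc i p p + 2 * g ^ 2 * ∫ x, p.1 x * p.1 x := by
  have iu : Integrable (fun x => p.1 x * p.1 x) volume := integrable_L2_mul p.1 p.1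
  have ia := S.isWeight_kappa.integrable_inner p.2 p.2
  have hu : ∫ x in S.K i, p.1 x * p.1 x = ∫ x, p.1 x * p.1 x := by
    refine setIntegral_eq_integral_of_ae_compl_eq_zero ?_
    filter_upwards [hp.1.1] with x hx hxi
    rw [hx hxi, mul_zero]
  rw [← hu]
  unfold aLoc
  rw [← integral_const_mul, ← integral_const_mul,
    ← integral_add (ia.const_mul _).integrableOn (iu.const_mul _).integrableOn]
  refine integral_mono_ae (S.isWeight_kappa.integrable_inner _ _).integrableOn
    ((ia.const_mul _).add (iu.const_mul _)).integrableOn (ae_restrict_of_ae ?_)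
  filter_upwards [hχ.mulPair_snd p, hp.2] with x hx hO
  have hk := S.kappa_nonneg x
  have hku : S.kappa x * (p.1 x * p.1 x) = p.1 x * p.1 x := by
    by_cases h : x ∈ S.OmK
    · rw [hO h]; ring
    · rw [kappa, if_neg h, one_mul]
  have hsq : ‖χ x • p.2 x + p.1 x • gradient χ x‖ ^ 2
      ≤ 2 * ‖p.2 x‖ ^ 2 + 2 * g ^ 2 * (p.1 x * p.1 x) := by
    have e1 : ‖χ x • p.2 x‖ ≤ ‖p.2 x‖ := by
      rw [norm_smul, Real.norm_eq_abs, abs_of_nonneg (h0 x)]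
      exact mul_le_of_le_one_left (norm_nonneg _) (h1 x)
    have e2 : ‖p.1 x • gradient χ x‖ ≤ |p.1 x| * g := by
      rw [norm_smul, Real.norm_eq_abs]
      exact mul_le_mul_of_nonneg_left (hg x) (abs_nonneg _)
    calc ‖χ x • p.2 x + p.1 x • gradient χ x‖ ^ 2 ≤ (‖p.2 x‖ + |p.1 x| * g) ^ 2 := by
          gcongr
          exact (norm_add_le _ _).trans (add_le_add e1 e2)
      _ ≤ 2 * (‖p.2 x‖ ^ 2 + (|p.1 x| * g) ^ 2) := add_sq_le
      _ = _ := by rw [mul_pow, sq_abs]; ring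
  rw [hx, real_inner_self_eq_norm_sq, real_inner_self_eq_norm_sq, ← hku]
  calc S.kappa x * ‖χ x • p.2 x + p.1 x • gradient χ x‖ ^ 2
      ≤ S.kappa x * (2 * ‖p.2 x‖ ^ 2 + 2 * g ^ 2 * (p.1 x * p.1 x)) := by gcongr
    _ = _ := by ring

/-! ### The multipliers of a function in the global space -/

theorem s_add_left (u u' v : L2 d) : S.s (u + u') v = S.s u v + S.s u' v := by
  simp only [s, sLoc_eq, map_add, LinearMap.add_apply, mul_add, Finset.sum_add_distrib]

theorem s_smul_left (c : ℝ) (u v : L2 d) : S.s (c • u) v = c * S.s u v := by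
  simp only [s, sLoc_eq, map_smul, LinearMap.smul_apply, smul_eq_mul, Finset.mul_sum]
  exact Finset.sum_congr rfl fun i _ => by ring

theorem s_comm (u v : L2 d) : S.s u v = S.s v u := by
  simp only [s, sLoc_eq]
  exact Finset.sum_congr rfl fun i _ => by rw [weightedForm_comm]

theorem exists_multipliers {W : Submodule ℝ (L2 d)} {J : Fin S.N → ℕ}
    {ξ : ∀ i, Fin (J i) → Pair d} {v : Pair d} (hv : v ∈ S.Vglo2 W ξ) :
    v ∈ S.V ∧ ∃ μ₁ ∈ W, ∃ μ₂ ∈ auxSpace ξ,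
      (∀ w ∈ S.V, S.a v w + S.s μ₁ w.1 + S.l2 μ₂ w.1 = 0) ∧ ∀ ν ∈ W, S.s v.1 ν = 0 := by
  induction hv using Submodule.span_induction with
  | mem v hv =>
    obtain ⟨i, j, hv, μ₁, h1, μ₂, h2, heq, hs, -⟩ := hv
    exact ⟨hv, μ₁, h1, μ₂, h2, heq, hs⟩
  | zero =>
    refine ⟨(H10Space S.Om).zero_mem, 0, W.zero_mem, 0, Submodule.zero_mem _, fun w _ => ?_,
      fun ν _ => ?_⟩
    · simp [a_eq, s, sLoc_eq, l2_eq]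
    · simp [s, sLoc_eq]
  | add v v' _ _ hv hv' =>
    obtain ⟨hv, μ₁, h1, μ₂, h2, heq, hs⟩ := hv
    obtain ⟨hv', μ₁', h1', μ₂', h2', heq', hs'⟩ := hv'
    refine ⟨(H10Space S.Om).add_mem hv hv', _, W.add_mem h1 h1', _, Submodule.add_mem _ h2 h2',
      fun w hw => ?_, fun ν hν => ?_⟩
    · have e1 := heq w hw
      have e2 := heq' w hw
      rw [s_add_left]
      simp only [a_eq, l2_eq, Prod.snd_add, map_add, LinearMap.add_apply] at e1 e2 ⊢
      linarith
    · rw [Prod.fst_add, s_add_left, hs ν hν, hs' ν hν, add_zero]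
  | smul c v _ hv =>
    obtain ⟨hv, μ₁, h1, μ₂, h2, heq, hs⟩ := hv
    refine ⟨(H10Space S.Om).smul_mem c hv, _, W.smul_mem c h1, _, Submodule.smul_mem _ c h2,
      fun w hw => ?_, fun ν hν => ?_⟩
    · have e1 := heq w hw
      rw [s_smul_left]
      simp only [a_eq, l2_eq, Prod.smul_snd, map_smul, LinearMap.smul_apply, smul_eq_mul] at e1 ⊢
      linear_combination c * e1
    · rw [Prod.smul_fst, s_smul_left, hs ν hν, mul_zero]

/-! ### The estimate of the multipliers -/

variable {S} {L J : Fin S.N → ℕ} {ψ : ∀ i, Fin (L i) → Pair d} {lam : ∀ i, Fin (L i) → ℝ}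
  {ξ : ∀ i, Fin (J i) → Pair d} {gam : ∀ i, Fin (J i) → ℝ} {E : ℝ}

theorem IsAux1.sum_mem (h : S.IsAux1 ψ lam) (i : Fin S.N) (c : Fin (L i) → ℝ) :
    ∑ j, c j • ψ i j ∈ S.Vk i :=
  (S.VkSpace i).sum_mem fun j _ => (S.VkSpace i).smul_mem _ ((h i).eigen j).1

theorem IsAux2.sum_mem {W : Submodule ℝ (L2 d)} (h : S.IsAux2 W ξ gam) (i : Fin S.N)
    (c : Fin (J i) → ℝ) : ∑ j, c j • ξ i j ∈ S.Vk i :=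
  (S.VkSpace i).sum_mem fun j _ => (S.VkSpace i).smul_mem _ ((h i).eigen j).1.1

theorem IsAux1.aLoc_sum_le (h : S.IsAux1 ψ lam) (hE : ∀ i j, lam i j ≤ E) (i : Fin S.N)
    (c : Fin (L i) → ℝ) {y : Pair d} (hy : y = ∑ j, c j • ψ i j) :
    S.aLoc i y y ≤ E * ((S.H ^ 2)⁻¹ * ∫ x, y.1 x * y.1 x) := by
  have hmem : y ∈ S.Vk i := hy ▸ h.sum_mem i c
  rw [← S.sLoc_eq_of_vanish i _ _ hmem.1.1 hmem.2, hy]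
  exact (h i).form_sum_le (hE i)
    ((weightedForm S.kappa S.isWeight_kappa (S.K i)).compl₁₂ (LinearMap.snd ℝ _ _)
      (LinearMap.snd ℝ _ _))
    ((S.H ^ 2)⁻¹ • (weightedForm S.kappa S.isWeight_kappa (S.K i)).compl₁₂ (LinearMap.fst ℝ _ _)
      (LinearMap.fst ℝ _ _))
    (fun u v => rfl) (fun u v => S.sLoc_eq i u.1 v.1) c

theorem IsAux2.aLoc_sum_le {W : Submodule ℝ (L2 d)} (h : S.IsAux2 W ξ gam)
    (hE : ∀ i j, gam i j ≤ E) (i : Fin S.N) (c : Fin (J i) → ℝ) {y : Pair d}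
    (hy : y = ∑ j, c j • ξ i j) :
    S.aLoc i y y ≤ E * ((S.H ^ 2)⁻¹ * ∫ x, y.1 x * y.1 x) := by
  have hmem : y ∈ S.Vk i := hy ▸ h.sum_mem i c
  have e1 : ∫ x in S.K i, y.1 x * y.1 x = ∫ x, y.1 x * y.1 x := by
    refine setIntegral_eq_integral_of_ae_compl_eq_zero ?_
    filter_upwards [hmem.1.1] with x hx hxi
    rw [hx hxi, mul_zero]
  rw [← e1, hy]
  exact (h i).form_sum_le (hE i)
    ((weightedForm S.kappa S.isWeight_kappa (S.K i)).compl₁₂ (LinearMap.snd ℝ _ _)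
      (LinearMap.snd ℝ _ _))
    ((S.H ^ 2)⁻¹ • (weightedForm _ isWeight_one (S.K i)).compl₁₂ (LinearMap.fst ℝ _ _)
      (LinearMap.fst ℝ _ _))
    (fun u v => rfl)
    (fun u v => congrArg ((S.H ^ 2)⁻¹ * ·) (setIntegral_mul_eq (S.K i) u.1 v.1)) c

/-- The two auxiliary spaces are orthogonal in `L²`, element by element. -/
theorem IsAux2.integral_mul_eq_zero {W : Submodule ℝ (L2 d)} (h : S.IsAux2 W ξ gam)
    (i : Fin S.N) (c : Fin (J i) → ℝ) {u : L2 d} (hu : u ∈ W) :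
    ∫ x, u x * (∑ j, c j • ξ i j).1 x = 0 := by
  have hmem := h.sum_mem i c
  have h1 : S.s (∑ j, c j • ξ i j).1 u = 0 := by
    have hj : ∀ j, S.s (ξ i j).1 u = 0 := fun j => by
      have := ((h i).eigen j).1.2.2 u hu
      rw [← this]
      simp [s, sLoc_eq]
    rw [Prod.fst_sum]
    clear hmem
    induction (Finset.univ : Finset (Fin (J i))) using Finset.induction_on with
    | empty => simp [s, sLoc_eq]
    | insert j t hjt ih =>
      rw [Finset.sum_insert hjt, s_add_left, ih, Prod.smul_fst, s_smul_left, hj, mul_zero, add_zero]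
  rw [s_comm, S.s_eq_of_vanish i _ _ hmem.1.1 hmem.2] at h1
  exact (mul_eq_zero.1 h1).resolve_left (inv_ne_zero (pow_ne_zero 2 S.H_pos.ne'))

/-- The local estimate of the multipliers. With `z = H⁻² μ₁ + μ₂` on `K_i`, the variational equation
is tested with `χ z` for a mass preserving cutoff function `χ`; the result bounds `‖z‖`, hence, by
orthogonality of the auxiliary spaces, `‖μ₂‖`. -/
theorem integral_multiplier_sq_le (hd : 0 < d) (hE0 : 0 ≤ E) (h1 : S.IsAux1 ψ lam)
    (h2 : S.IsAux2 (auxSpace ψ) ξ gam) (hlam : ∀ i j, lam i j ≤ E) (hgam : ∀ i j, gam i j ≤ E)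
    {D : ℝ} {B : Fin S.N → Pt d → ℝ} (hB : S.IsBubble D B) {v : Pair d} {μ₁ μ₂ : L2 d}
    (heq : ∀ w ∈ S.V, S.a v w + S.s μ₁ w.1 + S.l2 μ₂ w.1 = 0) (i : Fin S.N)
    {c : Fin (L i) → ℝ} {b : Fin (J i) → ℝ}
    (hμ₁ : ∀ᵐ x, x ∈ S.K i → (S.H ^ 2)⁻¹ * μ₁ x = (∑ j, c j • ψ i j).1 x)
    (hμ₂ : ∀ᵐ x, x ∈ S.K i → μ₂ x = (∑ j, b j • ξ i j).1 x) :
    ∫ x, (∑ j, b j • ξ i j).1 x * (∑ j, b j • ξ i j).1 x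
      ≤ (16 * E + 8 * cutoffConst d D (2 * E) ^ 2) * (S.H ^ 2)⁻¹ * S.aLoc i v v := by
  have hH := S.H_pos
  set y₁ := ∑ j, c j • ψ i j with hy₁
  set y₂ := ∑ j, b j • ξ i j with hy₂
  have hm1 : y₁ ∈ S.Vk i := h1.sum_mem i c
  have hm2 : y₂ ∈ S.Vk i := h2.sum_mem i b
  set z := y₁ + y₂ with hz
  have hmz : z ∈ S.Vk i := (S.VkSpace i).add_mem hm1 hm2
  have horth : ∫ x, y₁.1 x * y₂.1 x = 0 :=
    h2.integral_mul_eq_zero i b (fst_sum_mem_auxSpace ψ i c)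
  set Z := ∫ x, z.1 x * z.1 x with hZ
  have hZsum : Z = (∫ x, y₁.1 x * y₁.1 x) + ∫ x, y₂.1 x * y₂.1 x := by
    have e1 : Z = ∫ x, (y₁.1 x * y₁.1 x + 2 * (y₁.1 x * y₂.1 x) + y₂.1 x * y₂.1 x) := by
      refine integral_congr_ae ?_
      filter_upwards [ae_fst_add y₁ y₂] with x hx
      rw [hz, hx]
      ring
    rw [e1, integral_add, integral_add, integral_const_mul, horth, mul_zero, add_zero]
    · exact integrable_L2_mul _ _
    · exact (integrable_L2_mul _ _).const_mul _
    · exact (integrable_L2_mul _ _).add ((integrable_L2_mul _ _).const_mul _)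
    · exact integrable_L2_mul _ _
  have hZ0 : 0 ≤ Z := integral_nonneg fun x => mul_self_nonneg _
  have hy2Z : ∫ x, y₂.1 x * y₂.1 x ≤ Z := by
    have : 0 ≤ ∫ x, y₁.1 x * y₁.1 x := integral_nonneg fun x => mul_self_nonneg _
    linarith
  have henergy : S.aLoc i z z ≤ 2 * E * ((S.H ^ 2)⁻¹ * Z) := by
    have e1 := h1.aLoc_sum_le hlam i c hy₁
    have e2 := h2.aLoc_sum_le hgam i b hy₂
    have e3 := S.aLoc_add_self_le i y₁ y₂
    rw [hZsum]
    linarith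
  obtain ⟨χ, hχ, hχ0, hχ1, hχg, hmass⟩ :=
    S.exists_mass_preserving_cutoff hd (mul_nonneg zero_le_two hE0) hB i (E := 2 * E)
  set G := cutoffConst d D (2 * E)
  set w := hχ.mulPair z with hw
  have hhalf : Z / 2 ≤ ∫ x, χ x * (z.1 x * z.1 x) := by
    refine hmass z hmz.1 ?_
    calc S.H ^ 2 * (∫ x, inner ℝ (z.2 x) (z.2 x))
        ≤ S.H ^ 2 * (2 * E * ((S.H ^ 2)⁻¹ * Z)) := by
          gcongr
          exact (S.integral_inner_le_aLoc i hmz.1.2.1).trans henergy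
      _ = 2 * E * Z := by field_simp
  have hwV : w ∈ S.V := H10_mono (S.K_subset i) (hχ.mulPair_mem (S.K_open i) hmz.1)
  have hw1 : ∀ᵐ x, x ∉ S.K i → w.1 x = 0 := by
    filter_upwards [hχ.mulPair_fst z, hmz.1.1] with x hx h hxi
    rw [hw, hx, h hxi, mul_zero]
  have hwO : ∀ᵐ x, x ∈ S.OmK → w.1 x = 0 := by
    filter_upwards [hχ.mulPair_fst z, hmz.2] with x hx h hxi
    rw [hw, hx, h hxi, mul_zero]
  have hw2 : ∀ᵐ x, x ∉ S.K i → w.2 x = 0 := by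
    filter_upwards [hχ.mulPair_snd z, hmz.1.1, hmz.1.2.1] with x hx h h' hxi
    rw [hw, hx, h hxi, h' hxi, smul_zero, zero_smul, add_zero]
  have htest := heq w hwV
  rw [S.a_eq_aLoc_of_vanish i v w hw2, S.s_eq_of_vanish i _ _ hw1 hwO,
    S.l2_eq_of_vanish i _ _ hw1, add_assoc, ← integral_const_mul,
    ← integral_add ((integrable_L2_mul _ _).const_mul _) (integrable_L2_mul _ _)] at htest
  have hpair : ∫ x, ((S.H ^ 2)⁻¹ * (μ₁ x * w.1 x) + μ₂ x * w.1 x)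
      = ∫ x, χ x * (z.1 x * z.1 x) := by
    refine integral_congr_ae ?_
    filter_upwards [hw1, hχ.mulPair_fst z, hmz.1.1, hμ₁, hμ₂, ae_fst_add y₁ y₂]
      with x hx1 hx2 hx3 hx4 hx5 hx6
    by_cases hxi : x ∈ S.K i
    · rw [← mul_assoc, ← add_mul, hx4 hxi, hx5 hxi, ← hx6, hw, hx2]
      ring
    · rw [hx1 hxi, hx3 hxi]
      ring
  rw [hpair] at htest
  have hcs := S.aLoc_sq_le i v w
  have hww := S.aLoc_mulPair_le i hmz hχ hχ0 hχ1 hχg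
  have hww' : S.aLoc i w w ≤ (4 * E + 2 * G ^ 2) * ((S.H ^ 2)⁻¹ * Z) := by
    refine hww.trans ?_
    rw [mul_pow, inv_pow]
    linarith
  have hav := S.aLoc_self_nonneg i v
  have hsq : (Z / 2) ^ 2 ≤ S.aLoc i v w ^ 2 := by
    have : S.aLoc i v w = -∫ x, χ x * (z.1 x * z.1 x) := by linarith
    rw [this, neg_sq]
    gcongr
  have hfin : Z * Z ≤ (16 * E + 8 * G ^ 2) * (S.H ^ 2)⁻¹ * S.aLoc i v v * Z := by
    have := hsq.trans (hcs.trans (mul_le_mul_of_nonneg_left hww' hav))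
    linarith
  refine hy2Z.trans ?_
  -- the factor `Z` cancels unless it is zero, in which case the claim is trivial
  rcases hZ0.eq_or_lt with h | h
  · rw [← h]
    positivity
  · exact le_of_mul_le_mul_right hfin h

/-- The inverse inequality in squared form. -/
theorem a_self_le_of_mem_Vglo2 (hd : 0 < d) (hE0 : 0 ≤ E) (h1 : S.IsAux1 ψ lam)
    (h2 : S.IsAux2 (auxSpace ψ) ξ gam) (hlam : ∀ i j, lam i j ≤ E) (hgam : ∀ i j, gam i j ≤ E)
    {D : ℝ} {B : Fin S.N → Pt d → ℝ} (hB : S.IsBubble D B) {v : Pair d}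
    (hv : v ∈ S.Vglo2 (auxSpace ψ) ξ) :
    S.a v v ≤ (16 * E + 8 * cutoffConst d D (2 * E) ^ 2) * (S.H ^ 2)⁻¹ * ‖v.1‖ ^ 2 := by
  obtain ⟨hvV, μ₁, hμ₁, μ₂, hμ₂, heq, hs⟩ := S.exists_multipliers hv
  have hH := S.H_pos
  set Q := (16 * E + 8 * cutoffConst d D (2 * E) ^ 2) * (S.H ^ 2)⁻¹ with hQ
  have hQ0 : 0 ≤ Q := by positivity
  obtain ⟨c, hc⟩ := exists_sum_eq_of_mem_auxSpace
    ((auxSpace ψ).smul_mem (S.H ^ 2)⁻¹ hμ₁)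
  obtain ⟨b, hb⟩ := exists_sum_eq_of_mem_auxSpace hμ₂
  have hloc1 : ∀ i, ∀ᵐ x, x ∉ S.K i → (∑ j, c i j • ψ i j).1 x = 0 := fun i =>
    (h1.sum_mem i (c i)).1.1
  have hloc2 : ∀ i, ∀ᵐ x, x ∉ S.K i → (∑ j, b i j • ξ i j).1 x = 0 := fun i =>
    (h2.sum_mem i (b i)).1.1
  have hμ₂norm : ‖μ₂‖ ^ 2 ≤ Q * S.a v v := by
    rw [hb, S.norm_sum_sq_eq hloc2]
    calc ∑ i, ∫ x, (∑ j, b i j • ξ i j).1 x * (∑ j, b i j • ξ i j).1 x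
        ≤ ∑ i, Q * S.aLoc i v v := by
          refine Finset.sum_le_sum fun i _ =>
            integral_multiplier_sq_le hd hE0 h1 h2 hlam hgam hB heq i (c := c i) ?_ ?_
          · filter_upwards [S.ae_sum_eq_of_mem_K hloc1 i, Lp.coeFn_smul (S.H ^ 2)⁻¹ μ₁]
              with x hx hx' hxi
            rw [← hx hxi, ← hc, hx', Pi.smul_apply, smul_eq_mul]
          · filter_upwards [S.ae_sum_eq_of_mem_K hloc2 i] with x hx hxi
            rw [← hx hxi, ← hb]
      _ = Q * ∑ i, S.aLoc i v v := by rw [Finset.mul_sum]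
      _ ≤ Q * S.a v v := by
          gcongr
          exact S.sum_aLoc_le_a v
  have hav : S.a v v = - S.l2 μ₂ v.1 := by
    have := heq v hvV
    rw [s_comm, hs μ₁ hμ₁] at this
    linarith
  have hl2 : ∀ u : L2 d, S.l2 u u ≤ ‖u‖ ^ 2 := fun u => by
    rw [← real_inner_self_eq_norm_sq, L2.inner_def]
    simp only [inner_eq_mul]
    exact setIntegral_le_integral (integrable_L2_mul u u)
      (Filter.Eventually.of_forall fun x => mul_self_nonneg _)
  have hcs : S.l2 μ₂ v.1 ^ 2 ≤ S.l2 μ₂ μ₂ * S.l2 v.1 v.1 := by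
    simp only [l2_eq]
    exact weightedForm_sq_le _ (fun _ => zero_le_one) _ _ _
  have hl0 : 0 ≤ S.l2 v.1 v.1 := integral_nonneg fun x => mul_self_nonneg _
  have hfin : S.a v v * S.a v v ≤ Q * ‖v.1‖ ^ 2 * S.a v v := by
    calc S.a v v * S.a v v = S.l2 μ₂ v.1 ^ 2 := by rw [hav]; ring
      _ ≤ S.l2 μ₂ μ₂ * S.l2 v.1 v.1 := hcs
      _ ≤ ‖μ₂‖ ^ 2 * ‖v.1‖ ^ 2 := by
          gcongr
          · exact hl2 _
          · exact hl2 _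
      _ ≤ Q * S.a v v * ‖v.1‖ ^ 2 := by gcongr
      _ = _ := by ring
  have ha0 : 0 ≤ S.a v v := by
    rw [a_eq]
    exact weightedForm_self_nonneg _ S.kappa_nonneg _ _
  -- likewise for the factor `a(v, v)`
  rcases ha0.eq_or_lt with h | h
  · rw [← h]
    positivity
  · exact le_of_mul_le_mul_right hfin h

end Setup

end HighContrast

theorem mainTheorem5 (d : ℕ) (D E γ₁ γ₂ : ℝ) (hγ₁ : γ₁ < 1) :
    ∃ C : ℝ, 0 < C ∧
      ∀ (S : HighContrast.Setup d) (L J : Fin S.N → ℕ)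
        (ψ : ∀ i, Fin (L i) → HighContrast.Pair d) (lam : ∀ i, Fin (L i) → ℝ)
        (ξ : ∀ i, Fin (J i) → HighContrast.Pair d) (gam : ∀ i, Fin (J i) → ℝ)
        (B : Fin S.N → HighContrast.Pt d → ℝ),
        S.IsAux1 ψ lam →
        S.IsAux2 (HighContrast.auxSpace ψ) ξ gam →
        (∀ i j, lam i j ≤ E) →
        (∀ i j, gam i j ≤ E) →
        S.IsBubble D B →
        S.gammaOne (HighContrast.auxSpace ψ) (HighContrast.auxSpace ξ) B ≤ γ₁ →
        S.gammaTwo (HighContrast.auxSpace ξ) B ≤ ENNReal.ofReal γ₂ →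
        ∀ v ∈ S.Vglo2 (HighContrast.auxSpace ψ) ξ,
          S.energyNorm v ≤ C * S.H⁻¹ * ‖v.1‖ := by
  set Q := 16 * max E 0 + 8 * HighContrast.Setup.cutoffConst d D (2 * max E 0) ^ 2 with hQ
  have hQ0 : 0 ≤ Q := by positivity
  refine ⟨√Q + 1, by positivity, fun S L J ψ lam ξ gam B h1 h2 hlam hgam hB _ _ v hv => ?_⟩
  have hH := S.H_pos
  rcases Nat.eq_zero_or_pos d with rfl | hd
  · -- in dimension zero all gradients vanish
    have h0 : S.a v v = 0 := by
      refine MeasureTheory.integral_eq_zero_of_ae (Filter.Eventually.of_forall fun x => ?_)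
      simp [Subsingleton.elim (v.2 x) 0]
    rw [HighContrast.Setup.energyNorm, h0, Real.sqrt_zero]
    positivity
  · have h := HighContrast.Setup.a_self_le_of_mem_Vglo2 hd (le_max_right E 0) h1 h2
      (fun i j => (hlam i j).trans (le_max_left _ _)) (fun i j => (hgam i j).trans (le_max_left _ _))
      hB hv
    rw [← hQ] at h
    calc S.energyNorm v ≤ √(Q * (S.H ^ 2)⁻¹ * ‖v.1‖ ^ 2) := Real.sqrt_le_sqrt h
      _ = √Q * S.H⁻¹ * ‖v.1‖ := by
          rw [← inv_pow, Real.sqrt_mul (by positivity), Real.sqrt_mul hQ0,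
            Real.sqrt_sq (by positivity), Real.sqrt_sq (norm_nonneg _)]
      _ ≤ (√Q + 1) * S.H⁻¹ * ‖v.1‖ := by
          gcongr
          linarith
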